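/- Let $|\cdot|$ be a norm on $\mathbb{R}^n$ and let $\|\cdot\|$ be the induced operator norm on $n\times n$ matrices. Let $A\colon\mathbb{R}\to\mathbb{R}^{n\times n}$ be continuous, and let $f\colon\mathbb{R}\times\mathbb{R}^n\times\mathbb{R}^n\to\mathbb{R}^n$ be such that $t\mapsto f(t,x,y)$ is continuous for all $x,y$. Assume the following. (A) There are positive constants $M,\mu,\ell_1,\ell_2$ such that $\|A(t)\|\le M$, $|f(t,x,y)|\le\mu$ and $|f(t,x,y)-f(t,x',y')|\le \ell_1|x-x'|+\ell_2|y-y'|$ for all $t\in\mathbb{R}$ and $x,x',y,y'\in\mathbb{R}^n$. (B) There are sequences $(t_i)_{i\in\mathbb{Z}}$, $(\zeta_i)_{i\in\mathbb{Z}}$ of real numbers and a constant $\theta>0$ such that $t_i<t_{i+1}$, $t_i\le\zeta_i\le t_{i+1}$ and $t_{i+1}-t_i\le\theta$ for all $i$, $t_i\to\pm\infty$ as $i\to\pm\infty$, and $\gamma\colon\mathbb{R}\to\mathbb{R}$ satisfies $\gamma(t)=\zeta_i$ for $t\in[t_i,t_{i+1})$. Consider the systems $$y'(t)=A(t)y(t)\qquad(1)\qquad\text{and}\qquad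 x'(t)=A(t)x(t)+f(t,x(t),x(\gamma(t)))\qquad(2)$$ on $\mathbb{R}$. A solution of (2) is a continuous function $x\colon\mathbb{R}\to\mathbb{R}^n$ which is differentiable and satisfies (2) on each interval $(t_i,t_{i+1})$, and which has one-sided derivatives at each $t_i$, the right one satisfying (2). Suppose that (1) has an exponential dichotomy with constants $\tilde K\ge1$ and $\tilde\alpha>0$: if $\Phi$ is the fundamental matrix of (1) with $\Phi(0)=I$, there is a matrix $P$ with $P^2=P$ such that $\|\Phi(t)P\Phi^{-1}(s)\|\le\tilde Ke^{-\tilde\alpha(t-s)}$ for $t\ge s$ and $\|\Phi(t)(I-P)\Phi^{-1}(s)\|\le\tilde Ke^{-\tilde\alpha(s-t)}$ for $s>t$. Suppose moreover that $$2(\ell_1+\ell_2)\tilde K<\tilde\alpha\qquad\text{and}\qquad F_1(\theta)\,\ell_2\,\theta<1,\quad\text{where } F_1(\theta)=\frac{e^{(M+\ell_1)\theta}-1}{(M+\ell_1)\theta}.$$ Then (1) and (2) are strongly topologically equivalent. That is, there is $H\colon\mathbb{R}\times\mathbb{R}^n\to\mathbb{R}^n$ such that for each $t$ the map $u\mapsto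 H(t,u)$ is a homeomorphism of $\mathbb{R}^n$, with inverse denoted $u\mapsto L(t,u)$, such that - $H(t,u)-u$ and $L(t,u)-u$ are bounded on $\mathbb{R}\times\mathbb{R}^n$; - if $x$ is a solution of (2), then $t\mapsto H(t,x(t))$ is a solution of (1), and if $y$ is a solution of (1), then $t\mapsto L(t,y(t))$ is a solution of (2); - the maps $u\mapsto H(t,u)$ and $u\mapsto L(t,u)$ are uniformly continuous, with moduli of continuity that do not depend on $t$. If moreover $M>\tilde\alpha$, then (1) and (2) are Hölder strongly topologically equivalent. That is, $H$ and $L$ as above can be chosen such that, in addition, there are constants $C_1,D_1>1$ and $C_2,D_2\in(0,1)$ with $$|H(t,\xi)-H(t,\xi')|\le C_1|\xi-\xi'|^{C_2}\qquad\text{and}\qquad |L(t,\nu)-L(t,\nu')|\le D_1|\nu-\nu'|^{D_2}$$ for all $t\in\mathbb{R}$ and all $\xi,\xi',\nu,\nu'\in\mathbb{R}^n$ with $|\xi-\xi'|<1$ and $|\nu-\nu'|<1$. -/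

import Mathlib

open Set Filter Topology

noncomputable section

namespace DEPCAG

/-- Conditions on the piecewise constant argument `γ`: it takes the value `ζ i` on
`[τ i, τ (i + 1))`, where `τ i ≤ ζ i ≤ τ (i + 1)`, the sequence `τ` is strictly increasing and
unbounded in both directions, and its steps are at most `θ`. -/
structure ConditionB (τ ζ : ℤ → ℝ) (γ : ℝ → ℝ) (θ : ℝ) : Prop where
  lt_succ : ∀ i, τ i < τ (i + 1)
  le_zeta : ∀ i, τ i ≤ ζ i
  zeta_le : ∀ i, ζ i ≤ τ (i + 1)
  tendsto_top : Tendsto τ atTop atTop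
  tendsto_bot : Tendsto τ atBot atBot
  gamma_eq : ∀ i, ∀ t ∈ Ico (τ i) (τ (i + 1)), γ t = ζ i
  theta_pos : 0 < θ
  step_le : ∀ i, τ (i + 1) - τ i ≤ θ

variable {E : Type*} [NormedAddCommGroup E] [NormedSpace ℝ E]

/-- Conditions on the coefficient `A` and the perturbation `f`: boundedness by the positive
constants `M` and `μ`, and the Lipschitz condition with positive constants `ℓ₁`, `ℓ₂`. -/
structure ConditionA (A : ℝ → E →L[ℝ] E) (f : ℝ → E → E → E) (M μ ℓ₁ ℓ₂ : ℝ) : Prop where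
  M_pos : 0 < M
  norm_A_le : ∀ t, ‖A t‖ ≤ M
  mu_pos : 0 < μ
  norm_f_le : ∀ t x y, ‖f t x y‖ ≤ μ
  l₁_pos : 0 < ℓ₁
  l₂_pos : 0 < ℓ₂
  lipschitz : ∀ t x y x' y', ‖f t x y - f t x' y'‖ ≤ ℓ₁ * ‖x - x'‖ + ℓ₂ * ‖y - y'‖

/-- `u` is a solution on `ℝ` of the ordinary differential equation `u' = A(t) u`. -/
def IsLinearSolution (A : ℝ → E →L[ℝ] E) (u : ℝ → E) : Prop :=
  ∀ t, HasDerivAt u (A t (u t)) t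

/-- `u` is a solution on `ℝ` of `u'(t) = F(t, u(t), u(γ(t)))`, with switching times `τ`:
it is continuous, it is differentiable and satisfies the equation on each open interval
`(τ i, τ (i + 1))`, and at each `τ i` both one-sided derivatives exist and the right one satisfies
the equation. -/
structure IsSolution (τ : ℤ → ℝ) (γ : ℝ → ℝ) (F : ℝ → E → E → E) (u : ℝ → E) : Prop where
  continuous : Continuous u
  deriv_interior : ∀ i, ∀ t ∈ Ioo (τ i) (τ (i + 1)), HasDerivAt u (F t (u t) (u (γ t))) t
  deriv_right : ∀ i, HasDerivWithinAt u (F (τ i) (u (τ i)) (u (γ (τ i)))) (Ici (τ i)) (τ i)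
  deriv_left : ∀ i, ∃ d : E, HasDerivWithinAt u d (Iic (τ i)) (τ i)

/-- `Φ` is the Cauchy (fundamental) matrix of `u' = A(t) u` normalized by `Φ(0) = I`. -/
structure IsCauchyMatrix (A : ℝ → E →L[ℝ] E) (Φ : ℝ → E ≃L[ℝ] E) : Prop where
  at_zero : Φ 0 = ContinuousLinearEquiv.refl ℝ E
  deriv : ∀ t, HasDerivAt (fun s => (Φ s : E →L[ℝ] E)) ((A t).comp (Φ t : E →L[ℝ] E)) t

/-- The system `u' = A(t) u` has an exponential dichotomy on `ℝ` with constants `K ≥ 1`, `α > 0`: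
for some projection `P`, the norm of `Φ(t) P Φ(s)⁻¹` is at most `K exp (-α (t - s))` for `t ≥ s`
and the norm of `Φ(t) (I - P) Φ(s)⁻¹` is at most `K exp (-α (s - t))` for `s > t`. -/
def HasExponentialDichotomy (A : ℝ → E →L[ℝ] E) (K α : ℝ) : Prop :=
  1 ≤ K ∧ 0 < α ∧ ∃ Φ : ℝ → E ≃L[ℝ] E, IsCauchyMatrix A Φ ∧
    ∃ P : E →L[ℝ] E, P.comp P = P ∧
      (∀ t s, s ≤ t →
        ‖(Φ t : E →L[ℝ] E).comp (P.comp ((Φ s).symm : E →L[ℝ] E))‖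
          ≤ K * Real.exp (-α * (t - s))) ∧
      (∀ t s, t < s →
        ‖(Φ t : E →L[ℝ] E).comp ((ContinuousLinearMap.id ℝ E - P).comp
            ((Φ s).symm : E →L[ℝ] E))‖ ≤ K * Real.exp (-α * (s - t)))

/-- The family of homeomorphisms `u ↦ H t u`, with inverses `u ↦ L t u = (H t).symm u`, is a
topological equivalence between the system whose solutions are described by `Slin` and the one
whose solutions are described by `Snon`. -/
structure IsTopologicalEquivalence (Slin Snon : (ℝ → E) → Prop) (H : ℝ → E ≃ₜ E) : Prop where
  bounded : ∃ B : ℝ, ∀ t u, ‖H t u - u‖ ≤ B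
  bounded_symm : ∃ B : ℝ, ∀ t u, ‖(H t).symm u - u‖ ≤ B
  maps_solution : ∀ x : ℝ → E, Snon x → Slin (fun t => H t (x t))
  maps_solution_symm : ∀ y : ℝ → E, Slin y → Snon (fun t => (H t).symm (y t))

/-- The maps `u ↦ G t u` are uniformly continuous, with a modulus independent of `t`. -/
def UniformlyContinuousForAllTimes (G : ℝ → E → E) : Prop :=
  ∀ ε > 0, ∃ δ > 0, ∀ t u v, ‖u - v‖ < δ → ‖G t u - G t v‖ < ε

/-- The maps `u ↦ G t u` are Hölder continuous at distances less than one, with constants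
independent of `t`. -/
def HolderForAllTimes (G : ℝ → E → E) : Prop :=
  ∃ C > (1 : ℝ), ∃ c ∈ Ioo (0 : ℝ) 1, ∀ t u v, ‖u - v‖ < 1 → ‖G t u - G t v‖ ≤ C * ‖u - v‖ ^ c

def StronglyTopologicallyEquivalent (Slin Snon : (ℝ → E) → Prop) : Prop :=
  ∃ H : ℝ → E ≃ₜ E, IsTopologicalEquivalence Slin Snon H ∧
    UniformlyContinuousForAllTimes (fun t u => H t u) ∧
    UniformlyContinuousForAllTimes (fun t u => (H t).symm u)

def HolderStronglyTopologicallyEquivalent (Slin Snon : (ℝ → E) → Prop) : Prop :=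
  ∃ H : ℝ → E ≃ₜ E, IsTopologicalEquivalence Slin Snon H ∧
    UniformlyContinuousForAllTimes (fun t u => H t u) ∧
    UniformlyContinuousForAllTimes (fun t u => (H t).symm u) ∧
    HolderForAllTimes (fun t u => H t u) ∧
    HolderForAllTimes (fun t u => (H t).symm u)

/-- The function `F₁(θ) = (exp ((M + ℓ₁) θ) - 1) / ((M + ℓ₁) θ)`. -/
def F₁ (M ℓ₁ θ : ℝ) : ℝ := (Real.exp ((M + ℓ₁) * θ) - 1) / ((M + ℓ₁) * θ)

end DEPCAG

end

namespace DEPCAG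

open MeasureTheory

/-! ### Switching times and the piecewise constant argument -/

section SwitchingTimes

variable {τ ζ : ℤ → ℝ} {γ : ℝ → ℝ} {θ : ℝ}

/-! The dichotomy gives a Green operator `𝒢`, sending a bounded forcing `g` to a bounded solution of
`u' = A u + g`, with norm at most `2K/α`. If `x` solves (2), then `x - 𝒢 f(·, x, x ∘ γ)` solves (1).
Conversely, if `y` solves (1), the map `z ↦ 𝒢 f(·, y + z, (y + z) ∘ γ)` contracts with constant
`2K(ℓ₁ + ℓ₂)/α < 1`, and `y + z` solves (2) for its unique fixed point `z`. Evaluated at time `t` on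
the solution through a given point, these two recipes are `H t` and `L t`; uniqueness of `z` makes
them inverse, and boundedness of `f` keeps them at bounded distance from the identity.

`H` needs a unique global solution of (2) through each point. On one interval the delayed value is
an unknown constant, found as a fixed point; the condition on `F₁` says that the Grönwall constant
of this map is below one (`ConditionA.exists_piece`). The pieces are then glued in both time
directions, and `ConditionA.exists_growth` gives uniqueness.

For the moduli of continuity, two forcings along solutions starting `δ` apart at time `t` differ at
time `s` by at most `2μ`, and also by at most a multiple of `δ exp(κ|s - t|)`. The rate may exceed
`α`, but interpolating the two bounds (`le_interpolate`) leaves `δ^c exp(cκ|s - t|)`, which the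
Green kernel absorbs once `c` is small. So `H` and `L` are Hölder uniformly in `t`, and hence
uniformly continuous. -/

theorem ConditionB.strictMono (hB : ConditionB τ ζ γ θ) : StrictMono τ :=
  strictMono_int_of_lt_succ hB.lt_succ

theorem ConditionB.exists_mem_Ico (hB : ConditionB τ ζ γ θ) (t : ℝ) :
    ∃ i, t ∈ Ico (τ i) (τ (i + 1)) := by
  obtain ⟨b, hb⟩ := (hB.tendsto_top.eventually_gt_atTop t).exists
  obtain ⟨a, ha⟩ := (hB.tendsto_bot.eventually_le_atBot t).exists
  obtain ⟨i, hi, hmax⟩ := Int.exists_greatest_of_bdd (P := fun i => τ i ≤ t)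
    ⟨b, fun z hz => (hB.strictMono.lt_iff_lt.1 (hz.trans_lt hb)).le⟩ ⟨a, ha⟩
  refine ⟨i, hi, lt_of_not_ge fun h => ?_⟩
  have := hmax _ h
  omega

/-- Left derivatives at a switching time belong to the interval that ends there, hence this variant.
-/
theorem ConditionB.exists_mem_Ioc (hB : ConditionB τ ζ γ θ) (t : ℝ) :
    ∃ i, t ∈ Ioc (τ i) (τ (i + 1)) := by
  obtain ⟨i, hi⟩ := hB.exists_mem_Ico t
  rcases hi.1.lt_or_eq with h | h
  · exact ⟨i, h, hi.2.le⟩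
  · refine ⟨i - 1, ?_, ?_⟩
    · rw [← h]; exact hB.strictMono (by omega)
    · rw [← h, sub_add_cancel]

theorem ConditionB.zeta_mem (hB : ConditionB τ ζ γ θ) (i : ℤ) : ζ i ∈ Icc (τ i) (τ (i + 1)) :=
  ⟨hB.le_zeta i, hB.zeta_le i⟩

theorem ConditionB.abs_sub_le (hB : ConditionB τ ζ γ θ) {i : ℤ} {s t : ℝ}
    (hs : s ∈ Icc (τ i) (τ (i + 1))) (ht : t ∈ Icc (τ i) (τ (i + 1))) : |t - s| ≤ θ := by
  have := hB.step_le i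
  rw [abs_le]
  constructor <;> linarith [hs.1, hs.2, ht.1, ht.2]

theorem ConditionB.abs_gamma_sub_le (hB : ConditionB τ ζ γ θ) (t : ℝ) : |γ t - t| ≤ θ := by
  obtain ⟨i, hi⟩ := hB.exists_mem_Ico t
  rw [hB.gamma_eq i t hi]
  exact hB.abs_sub_le (Ico_subset_Icc_self hi) (hB.zeta_mem i)

/-- The preimage of any set is a countable union of the intervals on which `γ` is constant. -/
theorem ConditionB.measurable_gamma (hB : ConditionB τ ζ γ θ) : Measurable γ := by
  intro S _
  have : γ ⁻¹' S = ⋃ i ∈ {i | ζ i ∈ S}, Ico (τ i) (τ (i + 1)) := by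
    ext t
    simp only [mem_preimage, mem_ofPred_eq, mem_iUnion, exists_prop]
    constructor
    · intro h
      obtain ⟨i, hi⟩ := hB.exists_mem_Ico t
      exact ⟨i, by rwa [← hB.gamma_eq i t hi], hi⟩
    · rintro ⟨i, hi, ht⟩
      rwa [hB.gamma_eq i t ht]
  rw [this]
  exact MeasurableSet.biUnion (to_countable _) fun _ _ => measurableSet_Ico

end SwitchingTimes

/-! ### Grönwall estimates in both time directions -/

section Gronwall

variable {E : Type*} [NormedAddCommGroup E] [NormedSpace ℝ E]

theorem norm_le_gronwallBound_of_right {w : ℝ → E} {a b κ ε : ℝ} (hc : ContinuousOn w (Icc a b))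
    (h : ∀ t ∈ Ico a b, ∃ d, HasDerivWithinAt w d (Ici t) t ∧ ‖d‖ ≤ κ * ‖w t‖ + ε) :
    ∀ t ∈ Icc a b, ‖w t‖ ≤ gronwallBound ‖w a‖ κ ε (t - a) := by
  choose! d hd hle using h
  exact norm_le_gronwallBound_of_norm_deriv_right_le hc hd le_rfl hle

/-- Time reversal `r ↦ -r` reduces this to the right-derivative version. -/
theorem norm_le_gronwallBound_of_left {w : ℝ → E} {a b κ ε : ℝ} (hc : ContinuousOn w (Icc a b))
    (h : ∀ t ∈ Ioc a b, ∃ d, HasDerivWithinAt w d (Iic t) t ∧ ‖d‖ ≤ κ * ‖w t‖ + ε) :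
    ∀ t ∈ Icc a b, ‖w t‖ ≤ gronwallBound ‖w b‖ κ ε (b - t) := by
  intro t ht
  have key := norm_le_gronwallBound_of_right (w := fun r => w (-r)) (a := -b) (b := -a)
    (κ := κ) (ε := ε) (hc.comp continuous_neg.continuousOn fun r hr => ⟨by linarith [hr.2],
      by linarith [hr.1]⟩) (fun r hr => by
        obtain ⟨d, hd, hle⟩ := h (-r) ⟨by linarith [hr.2], by linarith [hr.1]⟩
        refine ⟨-d, ?_, by simpa using hle⟩
        have := HasDerivWithinAt.scomp (h := fun r : ℝ => -r) (h' := -1) (s := Ici r) r hd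
          (hasDerivAt_neg r).hasDerivWithinAt (fun u hu => by simpa using hu)
        simpa [Function.comp_def] using this) (-t) ⟨by linarith [ht.2], by linarith [ht.1]⟩
  simpa [sub_eq_neg_add, add_comm] using key

/-- Two-sided Grönwall inequality on a compact interval. -/
theorem norm_le_gronwallBound_of_Icc {w w' : ℝ → E} {a b κ ε : ℝ}
    (h : ∀ t ∈ Icc a b, HasDerivWithinAt w (w' t) (Icc a b) t)
    (hle : ∀ t ∈ Icc a b, ‖w' t‖ ≤ κ * ‖w t‖ + ε) {s t : ℝ} (hs : s ∈ Icc a b)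
    (ht : t ∈ Icc a b) : ‖w t‖ ≤ gronwallBound ‖w s‖ κ ε |t - s| := by
  have hc : ContinuousOn w (Icc a b) := fun t ht => (h t ht).continuousWithinAt
  rcases le_total s t with hst | hst
  · rw [abs_of_nonneg (sub_nonneg.2 hst)]
    refine norm_le_gronwallBound_of_right (b := t) (hc.mono (Icc_subset_Icc hs.1 ht.2))
      (fun r hr => ?_) t ⟨hst, le_rfl⟩
    have hr' : r ∈ Icc a b := ⟨hs.1.trans hr.1, hr.2.le.trans ht.2⟩
    exact ⟨w' r, (h r hr').mono_of_mem_nhdsWithin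
      (Icc_mem_nhdsGE_of_mem ⟨hr'.1, hr.2.trans_le ht.2⟩), hle r hr'⟩
  · rw [abs_of_nonpos (sub_nonpos.2 hst), neg_sub]
    refine norm_le_gronwallBound_of_left (a := t) (hc.mono (Icc_subset_Icc ht.1 hs.2))
      (fun r hr => ?_) t ⟨le_rfl, hst⟩
    have hr' : r ∈ Icc a b := ⟨ht.1.trans hr.1.le, hr.2.trans hs.2⟩
    exact ⟨w' r, (h r hr').mono_of_mem_nhdsWithin
      (Icc_mem_nhdsLE_of_mem ⟨ht.1.trans_lt hr.1, hr'.2⟩), hle r hr'⟩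

/-- A function whose one-sided derivatives are at most `κ` times its norm grows at most
exponentially in both directions. -/
theorem norm_le_exp_of_one_sided {w : ℝ → E} {κ : ℝ} (hc : Continuous w)
    (hr : ∀ t, ∃ d, HasDerivWithinAt w d (Ici t) t ∧ ‖d‖ ≤ κ * ‖w t‖)
    (hl : ∀ t, ∃ d, HasDerivWithinAt w d (Iic t) t ∧ ‖d‖ ≤ κ * ‖w t‖) (s t : ℝ) :
    ‖w t‖ ≤ Real.exp (κ * |t - s|) * ‖w s‖ := by
  rw [mul_comm, ← gronwallBound_ε0]
  rcases le_total s t with hst | hst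
  · rw [abs_of_nonneg (sub_nonneg.2 hst)]
    exact norm_le_gronwallBound_of_right (b := t) hc.continuousOn
      (fun r _ => by simpa using hr r) t ⟨hst, le_rfl⟩
  · rw [abs_of_nonpos (sub_nonpos.2 hst), neg_sub]
    exact norm_le_gronwallBound_of_left (a := t) hc.continuousOn
      (fun r _ => by simpa using hl r) t ⟨le_rfl, hst⟩

end Gronwall

/-! ### The kernel `exp(-a|t - s|)` -/

section LaplaceKernel

theorem integral_exp_neg_mul_abs {a : ℝ} (ha : 0 < a) (t : ℝ) :
    ∫ s : ℝ, Real.exp (-a * |t - s|) = 2 / a := by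
  rw [integral_sub_left_eq_self (fun s : ℝ => Real.exp (-a * |s|)),
    integral_comp_abs (f := fun s => Real.exp (-a * s)),
    integral_exp_mul_Ioi (neg_lt_zero.2 ha)]
  simp
  ring

/-- The integral of a non-integrable function is zero by convention, whereas here it is `2 / a > 0`.
-/
theorem integrable_exp_neg_mul_abs {a : ℝ} (ha : 0 < a) (t : ℝ) :
    Integrable fun s : ℝ => Real.exp (-a * |t - s|) := by
  by_contra h
  have h1 := integral_exp_neg_mul_abs ha t
  rw [integral_undef h] at h1
  exact (div_pos two_pos ha).ne h1

end LaplaceKernel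

/-! ### The fundamental matrix and its inverse -/

section CauchyMatrix

variable {E : Type*} [NormedAddCommGroup E] [NormedSpace ℝ E]
  {A : ℝ → E →L[ℝ] E} {Φ : ℝ → E ≃L[ℝ] E}

theorem IsCauchyMatrix.continuous (hΦ : IsCauchyMatrix A Φ) :
    Continuous fun t => (Φ t : E →L[ℝ] E) :=
  continuous_iff_continuousAt.2 fun t => (hΦ.deriv t).continuousAt

theorem IsCauchyMatrix.isLinearSolution_apply (hΦ : IsCauchyMatrix A Φ) (c : E) :
    IsLinearSolution A fun t => Φ t c := fun t => by
  have := (hΦ.deriv t).clm_apply (hasDerivAt_const t c)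
  simpa using this

theorem IsLinearSolution.continuous {u : ℝ → E} (hu : IsLinearSolution A u) : Continuous u :=
  continuous_iff_continuousAt.2 fun t => (hu t).continuousAt

theorem IsLinearSolution.sub {u v : ℝ → E} (hu : IsLinearSolution A u)
    (hv : IsLinearSolution A v) : IsLinearSolution A fun t => u t - v t := fun t => by
  rw [map_sub]
  exact (hu t).sub (hv t)

theorem IsLinearSolution.norm_le {M : ℝ} (hM : ∀ t, ‖A t‖ ≤ M) {u : ℝ → E}
    (hu : IsLinearSolution A u) (s t : ℝ) : ‖u t‖ ≤ Real.exp (M * |t - s|) * ‖u s‖ :=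
  norm_le_exp_of_one_sided hu.continuous
    (fun r => ⟨_, (hu r).hasDerivWithinAt, (A r).le_of_opNorm_le (hM r) _⟩)
    (fun r => ⟨_, (hu r).hasDerivWithinAt, (A r).le_of_opNorm_le (hM r) _⟩) s t

variable [CompleteSpace E]

/-- Chain rule with the derivative of inversion in the Banach algebra of operators. -/
theorem IsCauchyMatrix.hasDerivAt_symm (hΦ : IsCauchyMatrix A Φ) (t : ℝ) :
    HasDerivAt (fun s => ((Φ s).symm : E →L[ℝ] E)) (-(((Φ t).symm : E →L[ℝ] E).comp (A t))) t := by
  have h1 : ∀ s, ((Φ s).symm : E →L[ℝ] E) = Ring.inverse (Φ s : E →L[ℝ] E) := fun s => by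
    rw [ContinuousLinearMap.ringInverse_equiv, ContinuousLinearMap.inverse_equiv]
  have h2 := hasFDerivAt_ringInverse (𝕜 := ℝ) (R := E →L[ℝ] E)
    ((ContinuousLinearEquiv.unitsEquiv ℝ E).symm (Φ t))
  have h3 := HasFDerivAt.comp_hasDerivAt t (f := fun s => (Φ s : E →L[ℝ] E))
    (f' := (A t).comp (Φ t : E →L[ℝ] E)) h2 (hΦ.deriv t)
  simp only [h1]
  refine h3.congr_deriv ?_
  rw [← h1]
  ext v
  change -((Φ t).symm ((A t) ((Φ t) ((Φ t).symm v)))) = -((Φ t).symm (A t v))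
  simp

theorem IsCauchyMatrix.continuous_symm (hΦ : IsCauchyMatrix A Φ) :
    Continuous fun t => ((Φ t).symm : E →L[ℝ] E) :=
  continuous_iff_continuousAt.2 fun t => (hΦ.hasDerivAt_symm t).continuousAt

/-- `Φ⁻¹ u` has zero derivative, hence is constant. -/
theorem IsCauchyMatrix.eq_apply (hΦ : IsCauchyMatrix A Φ) {u : ℝ → E}
    (hu : IsLinearSolution A u) (s t : ℝ) : u t = Φ t ((Φ s).symm (u s)) := by
  have h : ∀ t, HasDerivAt (fun t => (Φ t).symm (u t)) 0 t := fun t => by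
    have := (hΦ.hasDerivAt_symm t).clm_apply (hu t)
    simpa using this
  have := is_const_of_deriv_eq_zero (fun t => (h t).differentiableAt) (fun t => (h t).deriv) t s
  rw [← this]
  simp

end CauchyMatrix

/-! ### Regularity of the perturbation along a function -/

section Forcing

variable {E : Type*} [NormedAddCommGroup E] [NormedSpace ℝ E]
  {A : ℝ → E →L[ℝ] E} {f : ℝ → E → E → E} {τ ζ : ℤ → ℝ} {γ : ℝ → ℝ} {M μ ℓ₁ ℓ₂ θ : ℝ}

/-- The perturbation evaluated along a function. -/
def forcing (f : ℝ → E → E → E) (γ : ℝ → ℝ) (x : ℝ → E) (s : ℝ) : E := f s (x s) (x (γ s))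

/-- Continuity in `t` alone becomes joint continuity because the Lipschitz bound in `(x, y)` is
uniform in `t`. -/
theorem ConditionA.continuous_uncurry (hA : ConditionA A f M μ ℓ₁ ℓ₂)
    (hf : ∀ x y, Continuous fun t => f t x y) :
    Continuous fun p : ℝ × E × E => f p.1 p.2.1 p.2.2 := by
  refine continuous_prod_of_continuous_lipschitzWith'
    (fun p : ℝ × E × E => f p.1 p.2.1 p.2.2) (Real.toNNReal (ℓ₁ + ℓ₂)) (fun t => ?_)
    (fun p => hf p.1 p.2)
  refine LipschitzWith.of_dist_le_mul fun p q => ?_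
  rw [Real.coe_toNNReal _ (add_pos hA.l₁_pos hA.l₂_pos).le, dist_eq_norm, dist_eq_norm]
  refine (hA.lipschitz _ _ _ _ _).trans ?_
  have h1 : ‖p.1 - q.1‖ ≤ ‖p - q‖ := norm_fst_le (p - q)
  have h2 : ‖p.2 - q.2‖ ≤ ‖p - q‖ := norm_snd_le (p - q)
  rw [add_mul]
  gcongr
  · exact hA.l₁_pos.le
  · exact hA.l₂_pos.le

theorem ConditionA.continuous_comp (hA : ConditionA A f M μ ℓ₁ ℓ₂)
    (hf : ∀ x y, Continuous fun t => f t x y) {x : ℝ → E} (hx : Continuous x) (c : E) :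
    Continuous fun s => f s (x s) c :=
  (hA.continuous_uncurry hf).comp (continuous_id.prodMk (hx.prodMk continuous_const))

theorem ConditionA.norm_forcing_le (hA : ConditionA A f M μ ℓ₁ ℓ₂) (x : ℝ → E) (s : ℝ) :
    ‖forcing f γ x s‖ ≤ μ :=
  hA.norm_f_le _ _ _

theorem ConditionA.stronglyMeasurable_forcing (hA : ConditionA A f M μ ℓ₁ ℓ₂)
    (hf : ∀ x y, Continuous fun t => f t x y) (hB : ConditionB τ ζ γ θ) {x : ℝ → E}
    (hx : Continuous x) : StronglyMeasurable (forcing f γ x) :=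
  (hA.continuous_uncurry hf).comp_stronglyMeasurable
    (stronglyMeasurable_id.prodMk (hx.stronglyMeasurable.prodMk
      (hx.comp_stronglyMeasurable hB.measurable_gamma.stronglyMeasurable)))

end Forcing

/-! ### Solutions, piecewise solutions and variation of constants -/

section Mild

variable {E : Type*} [NormedAddCommGroup E] [NormedSpace ℝ E]
  {A : ℝ → E →L[ℝ] E} {Φ : ℝ → E ≃L[ℝ] E} {f : ℝ → E → E → E} {τ ζ : ℤ → ℝ} {γ : ℝ → ℝ}
  {M μ ℓ₁ ℓ₂ θ : ℝ}

/-- `u` satisfies the variation of constants formula for `u' = A(t) u + g(t)`. -/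
def IsMildSolution (Φ : ℝ → E ≃L[ℝ] E) (g u : ℝ → E) : Prop :=
  ∃ c, ∀ t, u t = Φ t (c + ∫ r in (0 : ℝ)..t, (Φ r).symm (g r))

/-- On each closed interval between switching times, `u` is differentiable and satisfies the
equation with the delayed argument frozen at `ζ i`. -/
def IsPiecewiseSolution (τ ζ : ℤ → ℝ) (F : ℝ → E → E → E) (u : ℝ → E) : Prop :=
  ∀ i, ∀ t ∈ Icc (τ i) (τ (i + 1)),
    HasDerivWithinAt u (F t (u t) (u (ζ i))) (Icc (τ i) (τ (i + 1))) t

theorem IsPiecewiseSolution.hasDerivWithinAt_Ici {F : ℝ → E → E → E} {u : ℝ → E}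
    (hu : IsPiecewiseSolution τ ζ F u) {i : ℤ} {t : ℝ} (ht : t ∈ Ico (τ i) (τ (i + 1))) :
    HasDerivWithinAt u (F t (u t) (u (ζ i))) (Ici t) t :=
  (hu i t (Ico_subset_Icc_self ht)).mono_of_mem_nhdsWithin (Icc_mem_nhdsGE_of_mem ht)

theorem IsPiecewiseSolution.hasDerivWithinAt_Iic {F : ℝ → E → E → E} {u : ℝ → E}
    (hu : IsPiecewiseSolution τ ζ F u) {i : ℤ} {t : ℝ} (ht : t ∈ Ioc (τ i) (τ (i + 1))) :
    HasDerivWithinAt u (F t (u t) (u (ζ i))) (Iic t) t :=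
  (hu i t (Ioc_subset_Icc_self ht)).mono_of_mem_nhdsWithin (Icc_mem_nhdsLE_of_mem ht)

theorem IsPiecewiseSolution.continuous (hB : ConditionB τ ζ γ θ) {F : ℝ → E → E → E}
    {u : ℝ → E} (hu : IsPiecewiseSolution τ ζ F u) : Continuous u := by
  refine continuous_iff_continuousAt.2 fun t => ?_
  obtain ⟨i, hi⟩ := hB.exists_mem_Ico t
  obtain ⟨j, hj⟩ := hB.exists_mem_Ioc t
  exact continuousAt_iff_continuous_left_right.2
    ⟨(hu.hasDerivWithinAt_Iic hj).continuousWithinAt,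
      (hu.hasDerivWithinAt_Ici hi).continuousWithinAt⟩

theorem IsPiecewiseSolution.isSolution (hB : ConditionB τ ζ γ θ) {F : ℝ → E → E → E}
    {u : ℝ → E} (hu : IsPiecewiseSolution τ ζ F u) : IsSolution τ γ F u where
  continuous := hu.continuous hB
  deriv_interior i t ht := by
    rw [hB.gamma_eq i t (Ioo_subset_Ico_self ht)]
    exact (hu i t (Ioo_subset_Icc_self ht)).hasDerivAt (Icc_mem_nhds ht.1 ht.2)
  deriv_right i := by
    have hi : τ i ∈ Ico (τ i) (τ (i + 1)) := ⟨le_rfl, hB.lt_succ i⟩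
    rw [hB.gamma_eq i _ hi]
    exact hu.hasDerivWithinAt_Ici hi
  deriv_left i := by
    obtain ⟨j, hj⟩ := hB.exists_mem_Ioc (τ i)
    exact ⟨_, hu.hasDerivWithinAt_Iic hj⟩

theorem IsSolution.hasDerivWithinAt_Ici (hB : ConditionB τ ζ γ θ) {F : ℝ → E → E → E}
    {u : ℝ → E} (hu : IsSolution τ γ F u) (t : ℝ) :
    HasDerivWithinAt u (F t (u t) (u (γ t))) (Ici t) t := by
  obtain ⟨i, hi⟩ := hB.exists_mem_Ico t
  rcases hi.1.eq_or_lt with h | h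
  · rw [← h]
    exact hu.deriv_right i
  · exact (hu.deriv_interior i t ⟨h, hi.2⟩).hasDerivWithinAt

theorem IsMildSolution.isLinearSolution_sub (hΦ : IsCauchyMatrix A Φ) {g u v : ℝ → E}
    (hu : IsMildSolution Φ g u) (hv : IsMildSolution Φ g v) :
    IsLinearSolution A fun t => u t - v t := by
  obtain ⟨c, hc⟩ := hu
  obtain ⟨d, hd⟩ := hv
  have : (fun t => u t - v t) = fun t => Φ t (c - d) := by
    ext t
    rw [hc, hd, ← map_sub]
    congr 1
    abel
  rw [this]
  exact hΦ.isLinearSolution_apply _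

variable [CompleteSpace E]

theorem IsCauchyMatrix.stronglyMeasurable_symm_apply (hΦ : IsCauchyMatrix A Φ) {g : ℝ → E}
    (hg : StronglyMeasurable g) : StronglyMeasurable fun r => (Φ r).symm (g r) :=
  (isBoundedBilinearMap_apply (𝕜 := ℝ) (E := E) (F := E)).continuous.comp_stronglyMeasurable
    (hΦ.continuous_symm.stronglyMeasurable.prodMk hg)

theorem IsCauchyMatrix.intervalIntegrable (hΦ : IsCauchyMatrix A Φ) {g : ℝ → E} {D : ℝ}
    (hg : StronglyMeasurable g) (hD : ∀ t, ‖g t‖ ≤ D) (a b : ℝ) :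
    IntervalIntegrable (fun r => (Φ r).symm (g r)) volume a b := by
  have hc : Continuous fun r => ‖((Φ r).symm : E →L[ℝ] E)‖ * D :=
    hΦ.continuous_symm.norm.mul continuous_const
  refine (hc.intervalIntegrable a b).mono_fun
    (hΦ.stronglyMeasurable_symm_apply hg).aestronglyMeasurable (Eventually.of_forall fun r => ?_)
  refine (((Φ r).symm : E →L[ℝ] E).le_opNorm_of_le (hD r)).trans (le_abs_self _)

theorem IsMildSolution.continuous (hΦ : IsCauchyMatrix A Φ) {g u : ℝ → E} {D : ℝ}
    (hg : StronglyMeasurable g) (hD : ∀ t, ‖g t‖ ≤ D) (hu : IsMildSolution Φ g u) :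
    Continuous u := by
  obtain ⟨c, hc⟩ := hu
  have h := intervalIntegral.continuous_primitive (hΦ.intervalIntegrable hg hD) 0
  rw [funext hc]
  exact hΦ.continuous.clm_apply (continuous_const.add h)

theorem IsMildSolution.linear_add (hΦ : IsCauchyMatrix A Φ) {g u v : ℝ → E}
    (hu : IsLinearSolution A u) (hv : IsMildSolution Φ g v) :
    IsMildSolution Φ g fun t => u t + v t := by
  obtain ⟨c, hc⟩ := hv
  refine ⟨(Φ 0).symm (u 0) + c, fun t => ?_⟩
  simp only [hc]
  rw [hΦ.eq_apply hu 0 t, ← map_add, add_assoc]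

/-- `Φ⁻¹ u` has right derivative `Φ⁻¹ g` at every time, switching times included, so the fundamental
theorem of calculus for right derivatives applies; `g` itself may jump. -/
theorem IsSolution.isMildSolution (hΦ : IsCauchyMatrix A Φ) (hA : ConditionA A f M μ ℓ₁ ℓ₂)
    (hf : ∀ x y, Continuous fun t => f t x y) (hB : ConditionB τ ζ γ θ) {u : ℝ → E}
    (hu : IsSolution τ γ (fun t x y => A t x + f t x y) u) :
    IsMildSolution Φ (forcing f γ u) u := by
  have hm := hA.stronglyMeasurable_forcing hf hB hu.continuous
  have hint := hΦ.intervalIntegrable hm (hA.norm_forcing_le u)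
  have hder : ∀ t, HasDerivWithinAt (fun t => (Φ t).symm (u t))
      ((Φ t).symm (forcing f γ u t)) (Ioi t) t := fun t => by
    have := (hΦ.hasDerivAt_symm t).hasDerivWithinAt.clm_apply
      ((hu.hasDerivWithinAt_Ici hB t).mono Ioi_subset_Ici_self)
    simpa [forcing] using this
  refine ⟨(Φ 0).symm (u 0), fun t => ?_⟩
  rw [intervalIntegral.integral_eq_sub_of_hasDeriv_right
    (hΦ.continuous_symm.clm_apply hu.continuous).continuousOn (fun t _ => hder t) (hint 0 t)]
  simp

/-- On one interval the integrand can be replaced by its continuous version with delayed value `u (ζ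
i)`, and the resulting primitive is differentiable up to both endpoints. -/
theorem IsMildSolution.isPiecewiseSolution (hΦ : IsCauchyMatrix A Φ)
    (hA : ConditionA A f M μ ℓ₁ ℓ₂) (hf : ∀ x y, Continuous fun t => f t x y)
    (hB : ConditionB τ ζ γ θ) {u : ℝ → E} (hc : Continuous u)
    (hu : IsMildSolution Φ (forcing f γ u) u) :
    IsPiecewiseSolution τ ζ (fun t x y => A t x + f t x y) u := by
  intro i t ht
  obtain ⟨c, hc'⟩ := hu
  have hm := hA.stronglyMeasurable_forcing hf hB hc
  have hint := hΦ.intervalIntegrable hm (hA.norm_forcing_le u)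
  have hcont : Continuous fun r => (Φ r).symm (f r (u r) (u (ζ i))) :=
    hΦ.continuous_symm.clm_apply (hA.continuous_comp hf hc _)
  set d : E := c + ∫ r in (0 : ℝ)..τ i, (Φ r).symm (forcing f γ u r) with hd
  have heq : ∀ s ∈ Icc (τ i) (τ (i + 1)),
      u s = Φ s (d + ∫ r in τ i..s, (Φ r).symm (f r (u r) (u (ζ i)))) := fun s hs => by
    have h1 : ∫ r in τ i..s, (Φ r).symm (forcing f γ u r)
        = ∫ r in τ i..s, (Φ r).symm (f r (u r) (u (ζ i))) := by
      -- The right endpoint is discarded as a null set, since `γ` may already have jumped to `ζ (i +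
      -- 1)` there.
      rw [intervalIntegral.integral_of_le hs.1, intervalIntegral.integral_of_le hs.1,
        integral_Ioc_eq_integral_Ioo, integral_Ioc_eq_integral_Ioo]
      refine setIntegral_congr_fun measurableSet_Ioo fun r hr => ?_
      simp only [forcing]
      rw [hB.gamma_eq i r ⟨hr.1.le, hr.2.trans_le hs.2⟩]
    rw [hc' s, ← h1, hd, add_assoc, intervalIntegral.integral_add_adjacent_intervals
      (hint _ _) (hint _ _)]
  have hder : HasDerivAt
      (fun s => Φ s (d + ∫ r in τ i..s, (Φ r).symm (f r (u r) (u (ζ i)))))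
      (A t (Φ t (d + ∫ r in τ i..t, (Φ r).symm (f r (u r) (u (ζ i)))))
        + Φ t ((Φ t).symm (f t (u t) (u (ζ i))))) t :=
    (hΦ.deriv t).clm_apply ((hcont.integral_hasStrictDerivAt (τ i) t).hasDerivAt.const_add d)
  rw [← heq t ht, ContinuousLinearEquiv.apply_symm_apply] at hder
  exact hder.hasDerivWithinAt.congr heq (heq t ht)

/-- A solution is only required to possess a left derivative at switching times; the integral
formula identifies its value. -/
theorem IsSolution.isPiecewiseSolution (hΦ : IsCauchyMatrix A Φ)
    (hA : ConditionA A f M μ ℓ₁ ℓ₂) (hf : ∀ x y, Continuous fun t => f t x y)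
    (hB : ConditionB τ ζ γ θ) {u : ℝ → E}
    (hu : IsSolution τ γ (fun t x y => A t x + f t x y) u) :
    IsPiecewiseSolution τ ζ (fun t x y => A t x + f t x y) u :=
  (hu.isMildSolution hΦ hA hf hB).isPiecewiseSolution hΦ hA hf hB hu.continuous

end Mild

/-! ### The Green operator of the dichotomy -/

section Green

variable {E : Type*} [NormedAddCommGroup E] [NormedSpace ℝ E]
  {A : ℝ → E →L[ℝ] E} {Φ : ℝ → E ≃L[ℝ] E} {P : E →L[ℝ] E} {K α : ℝ}

/-- The Green function of the dichotomy with projection `P`. -/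
noncomputable def greenKernel (Φ : ℝ → E ≃L[ℝ] E) (P : E →L[ℝ] E) (t s : ℝ) : E →L[ℝ] E :=
  open Classical in
  if s ≤ t then (Φ t : E →L[ℝ] E).comp (P.comp ((Φ s).symm : E →L[ℝ] E))
  else -((Φ t : E →L[ℝ] E).comp ((ContinuousLinearMap.id ℝ E - P).comp
    ((Φ s).symm : E →L[ℝ] E)))

/-- The bounded solution of `u' = A(t) u + g(t)` given by the Green function. -/
noncomputable def greenOperator (Φ : ℝ → E ≃L[ℝ] E) (P : E →L[ℝ] E) (g : ℝ → E) (t : ℝ) : E :=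
  ∫ s, greenKernel Φ P t s (g s)

/-- The norm bounds of an exponential dichotomy for the fundamental matrix `Φ`. -/
structure IsDichotomy (A : ℝ → E →L[ℝ] E) (Φ : ℝ → E ≃L[ℝ] E) (P : E →L[ℝ] E) (K α : ℝ) :
    Prop where
  one_le : 1 ≤ K
  alpha_pos : 0 < α
  cauchy : IsCauchyMatrix A Φ
  stable : ∀ t s, s ≤ t → ‖(Φ t : E →L[ℝ] E).comp (P.comp ((Φ s).symm : E →L[ℝ] E))‖
    ≤ K * Real.exp (-α * (t - s))
  unstable : ∀ t s, t < s → ‖(Φ t : E →L[ℝ] E).comp ((ContinuousLinearMap.id ℝ E - P).comp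
    ((Φ s).symm : E →L[ℝ] E))‖ ≤ K * Real.exp (-α * (s - t))

theorem IsDichotomy.norm_greenKernel_le (h : IsDichotomy A Φ P K α) (t s : ℝ) :
    ‖greenKernel Φ P t s‖ ≤ K * Real.exp (-α * |t - s|) := by
  unfold greenKernel
  split_ifs with hst
  · rw [abs_of_nonneg (sub_nonneg.2 hst)]
    exact h.stable t s hst
  · rw [norm_neg, abs_of_neg (by linarith), neg_sub]
    exact h.unstable t s (not_le.1 hst)

/-- The Green kernel integrates exponentially weighted functions to functions with the same
weight. -/
theorem IsDichotomy.norm_greenKernel_apply_le (h : IsDichotomy A Φ P K α) {g : ℝ → E}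
    {D β t₀ : ℝ} (hβ : 0 ≤ β) (hD : 0 ≤ D) (hg : ∀ s, ‖g s‖ ≤ D * Real.exp (β * |s - t₀|))
    (t s : ℝ) : ‖greenKernel Φ P t s (g s)‖
      ≤ K * D * Real.exp (β * |t - t₀|) * Real.exp (-(α - β) * |t - s|) := by
  have hK : 0 ≤ K := zero_le_one.trans h.one_le
  calc ‖greenKernel Φ P t s (g s)‖
      ≤ K * Real.exp (-α * |t - s|) * (D * Real.exp (β * |s - t₀|)) :=
        (greenKernel Φ P t s).le_of_opNorm_le_of_le (h.norm_greenKernel_le t s) (hg s)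
    _ ≤ K * Real.exp (-α * |t - s|) * (D * Real.exp (β * |t - t₀| + β * |t - s|)) := by
        gcongr
        rw [← mul_add]
        refine mul_le_mul_of_nonneg_left ?_ hβ
        rw [abs_sub_comm t s, add_comm]
        exact abs_sub_le s t t₀
    _ = _ := by
        rw [Real.exp_add, show -(α - β) * |t - s| = -α * |t - s| + β * |t - s| by ring,
          Real.exp_add]
        ring

theorem IsDichotomy.norm_greenOperator_le (h : IsDichotomy A Φ P K α) {g : ℝ → E}
    {D β t₀ : ℝ} (hβ : 0 ≤ β) (hβα : β < α) (hD : 0 ≤ D)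
    (hg : ∀ s, ‖g s‖ ≤ D * Real.exp (β * |s - t₀|)) (t : ℝ) :
    ‖greenOperator Φ P g t‖ ≤ 2 * K / (α - β) * D * Real.exp (β * |t - t₀|) := by
  have hpos : 0 < α - β := sub_pos.2 hβα
  refine (norm_integral_le_of_norm_le ((integrable_exp_neg_mul_abs hpos t).const_mul _)
    (Eventually.of_forall (h.norm_greenKernel_apply_le hβ hD hg t))).trans_eq ?_
  rw [integral_const_mul, integral_exp_neg_mul_abs hpos]
  ring

variable [CompleteSpace E]

theorem IsDichotomy.stronglyMeasurable_greenKernel (h : IsDichotomy A Φ P K α) (t : ℝ) :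
    StronglyMeasurable (greenKernel Φ P t) := by
  have hc := h.cauchy.continuous_symm
  exact StronglyMeasurable.ite measurableSet_Iic
    (continuous_const.clm_comp (continuous_const.clm_comp hc)).stronglyMeasurable
    (continuous_const.clm_comp (continuous_const.clm_comp hc)).neg.stronglyMeasurable

theorem IsDichotomy.integrable (h : IsDichotomy A Φ P K α) {g : ℝ → E} {D : ℝ}
    (hg : StronglyMeasurable g) (hD : ∀ s, ‖g s‖ ≤ D) (t : ℝ) :
    Integrable fun s => greenKernel Φ P t s (g s) := by
  have hD0 : 0 ≤ D := (norm_nonneg _).trans (hD 0)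
  refine Integrable.mono' (g := fun s => K * D * Real.exp (0 * |t - 0|)
      * Real.exp (-(α - 0) * |t - s|))
    ((integrable_exp_neg_mul_abs (by simpa using h.alpha_pos) t).const_mul _)
    ((isBoundedBilinearMap_apply (𝕜 := ℝ) (E := E) (F := E)).continuous.comp_stronglyMeasurable
      ((h.stronglyMeasurable_greenKernel t).prodMk hg)).aestronglyMeasurable
    (Eventually.of_forall (h.norm_greenKernel_apply_le le_rfl hD0 (by simpa using hD) t))

theorem IsDichotomy.greenOperator_sub (h : IsDichotomy A Φ P K α) {g g' : ℝ → E} {D : ℝ}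
    (hg : StronglyMeasurable g) (hD : ∀ s, ‖g s‖ ≤ D) (hg' : StronglyMeasurable g')
    (hD' : ∀ s, ‖g' s‖ ≤ D) (t : ℝ) :
    greenOperator Φ P g t - greenOperator Φ P g' t
      = greenOperator Φ P (fun s => g s - g' s) t := by
  simp only [greenOperator, map_sub]
  rw [integral_sub (h.integrable hg hD t) (h.integrable hg' hD' t)]

/-- With `p = P Φ⁻¹ g` and `q = (I - P) Φ⁻¹ g`, the Green integral is `Φ(t)` applied to the integral
of `p` over `(-∞, t]` minus that of `q` over `(t, ∞)`. Moving the splitting point from `t` to `0`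
costs the integral of `p + q = Φ⁻¹ g` over `[0, t]`. -/
theorem IsDichotomy.isMildSolution_greenOperator (h : IsDichotomy A Φ P K α) {g : ℝ → E}
    {D : ℝ} (hg : StronglyMeasurable g) (hD : ∀ s, ‖g s‖ ≤ D) :
    IsMildSolution Φ g (greenOperator Φ P g) := by
  set p : ℝ → E := fun s => P ((Φ s).symm (g s)) with hp
  set q : ℝ → E := fun s => (Φ s).symm (g s) - P ((Φ s).symm (g s)) with hq
  have hgp : ∀ t, ∀ s ∈ Iic t, greenKernel Φ P t s (g s) = Φ t (p s) := fun t s hs => by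
    simp [greenKernel, mem_Iic.1 hs, hp]
  have hgq : ∀ t, ∀ s ∈ Ioi t, greenKernel Φ P t s (g s) = Φ t (-q s) := fun t s hs => by
    simp [greenKernel, not_le.2 (mem_Ioi.1 hs), hq]
  -- Integrability of `p`, and likewise of `q`, is transported from the Green kernel by the fixed
  -- operator `Φ(t)⁻¹`.
  have hip : ∀ t, IntegrableOn p (Iic t) := fun t => by
    have h1 : IntegrableOn (fun s => Φ t (p s)) (Iic t) :=
      (h.integrable hg hD t).integrableOn.congr_fun (hgp t) measurableSet_Iic
    simpa [IntegrableOn] using ((Φ t).symm : E →L[ℝ] E).integrable_comp h1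
  have hiq : ∀ t, IntegrableOn q (Ioi t) := fun t => by
    have h1 : IntegrableOn (fun s => Φ t (-q s)) (Ioi t) :=
      (h.integrable hg hD t).integrableOn.congr_fun (hgq t) measurableSet_Ioi
    simpa [IntegrableOn] using (((Φ t).symm : E →L[ℝ] E).integrable_comp h1).neg
  have hip' : ∀ t, IntervalIntegrable p volume 0 t := fun t =>
    ((hip (max 0 t)).mono_set (by
      rw [uIcc_eq_union]
      exact union_subset (Icc_subset_Iic_self.trans (Iic_subset_Iic.2 (le_max_right _ _)))
        (Icc_subset_Iic_self.trans (Iic_subset_Iic.2 (le_max_left _ _))))).intervalIntegrable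
  have hiq' : ∀ t, IntervalIntegrable q volume 0 t := fun t =>
    (h.cauchy.intervalIntegrable hg hD 0 t).sub (hip' t)
  refine ⟨(∫ s in Iic 0, p s) - ∫ s in Ioi 0, q s, fun t => ?_⟩
  have h1 : greenOperator Φ P g t = Φ t ((∫ s in Iic t, p s) - ∫ s in Ioi t, q s) := by
    rw [greenOperator, ← integral_add_compl measurableSet_Iic (h.integrable hg hD t),
      compl_Iic, setIntegral_congr_fun measurableSet_Iic (hgp t),
      setIntegral_congr_fun measurableSet_Ioi (hgq t)]
    have e1 := (Φ t).integral_comp_comm (μ := volume.restrict (Iic t)) p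
    have e2 := (Φ t).integral_comp_comm (μ := volume.restrict (Ioi t)) fun s => -q s
    rw [e1, e2, integral_neg, ← map_add, sub_eq_add_neg]
  have h2 := intervalIntegral.integral_Iic_sub_Iic (hip 0) (hip t)
  have h3 := intervalIntegral.integral_interval_add_Ioi (hiq 0) (hiq t)
  have h4 : ∫ r in (0 : ℝ)..t, (Φ r).symm (g r)
      = (∫ r in (0 : ℝ)..t, p r) + ∫ r in (0 : ℝ)..t, q r := by
    rw [← intervalIntegral.integral_add (hip' t) (hiq' t)]
    simp [hp, hq]
  rw [h1, h4, ← h2, ← h3]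
  congr 1
  abel

end Green

/-! ### Global existence, uniqueness and growth for the nonlinear equation -/

section Flow

variable {E : Type*} [NormedAddCommGroup E] [NormedSpace ℝ E]
  {A : ℝ → E →L[ℝ] E} {Φ : ℝ → E ≃L[ℝ] E} {f : ℝ → E → E → E} {τ ζ : ℤ → ℝ} {γ : ℝ → ℝ}
  {M μ ℓ₁ ℓ₂ θ : ℝ}

theorem ConditionB.eq_of_mem_Ico (hB : ConditionB τ ζ γ θ) {i j : ℤ} {t : ℝ}
    (hi : t ∈ Ico (τ i) (τ (i + 1))) (hj : t ∈ Ico (τ j) (τ (j + 1))) : i = j := by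
  have h1 := hB.strictMono.lt_iff_lt.1 (hi.1.trans_lt hj.2)
  have h2 := hB.strictMono.lt_iff_lt.1 (hj.1.trans_lt hi.2)
  omega

/-- The right-hand side is the Grönwall constant for the influence of the frozen value on one
interval, at rate `M + ℓ₁` over time `θ`. -/
theorem F₁_mul_eq (hM : 0 < M + ℓ₁) (hθ : 0 < θ) :
    F₁ M ℓ₁ θ * ℓ₂ * θ = ℓ₂ / (M + ℓ₁) * (Real.exp ((M + ℓ₁) * θ) - 1) := by
  unfold F₁
  field_simp

/-- Difference of two solutions of the equation with frozen delayed arguments `c` and `c'`. -/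
theorem ConditionA.norm_sub_le_of_frozen (hA : ConditionA A f M μ ℓ₁ ℓ₂) {a b : ℝ} {x x' : ℝ → E}
    {c c' : E}
    (hx : ∀ t ∈ Icc a b, HasDerivWithinAt x (A t (x t) + f t (x t) c) (Icc a b) t)
    (hx' : ∀ t ∈ Icc a b, HasDerivWithinAt x' (A t (x' t) + f t (x' t) c') (Icc a b) t)
    {s t : ℝ} (hs : s ∈ Icc a b) (ht : t ∈ Icc a b) (hθ : |t - s| ≤ θ) :
    ‖x t - x' t‖ ≤ Real.exp ((M + ℓ₁) * θ) * ‖x s - x' s‖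
      + ℓ₂ / (M + ℓ₁) * (Real.exp ((M + ℓ₁) * θ) - 1) * ‖c - c'‖ := by
  have hκ : 0 < M + ℓ₁ := add_pos hA.M_pos hA.l₁_pos
  have hder : ∀ t ∈ Icc a b, HasDerivWithinAt (fun t => x t - x' t)
      (A t (x t - x' t) + (f t (x t) c - f t (x' t) c')) (Icc a b) t := fun t ht =>
    ((hx t ht).sub (hx' t ht)).congr_deriv (by rw [map_sub]; abel)
  have hle : ∀ t ∈ Icc a b, ‖A t (x t - x' t) + (f t (x t) c - f t (x' t) c')‖
      ≤ (M + ℓ₁) * ‖x t - x' t‖ + ℓ₂ * ‖c - c'‖ := fun t _ => by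
    have h1 := (A t).le_of_opNorm_le (hA.norm_A_le t) (x t - x' t)
    have h2 := hA.lipschitz t (x t) c (x' t) c'
    linarith [norm_add_le (A t (x t - x' t)) (f t (x t) c - f t (x' t) c')]
  have h := norm_le_gronwallBound_of_Icc hder hle hs ht
  rw [gronwallBound_of_K_ne_0 hκ.ne'] at h
  beta_reduce at h
  have hexp : Real.exp ((M + ℓ₁) * |t - s|) ≤ Real.exp ((M + ℓ₁) * θ) :=
    Real.exp_le_exp.2 (mul_le_mul_of_nonneg_left hθ hκ.le)
  have hc : 0 ≤ ℓ₂ * ‖c - c'‖ / (M + ℓ₁) :=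
    div_nonneg (mul_nonneg hA.l₂_pos.le (norm_nonneg _)) hκ.le
  calc ‖x t - x' t‖ ≤ _ := h
    _ ≤ ‖x s - x' s‖ * Real.exp ((M + ℓ₁) * θ)
        + ℓ₂ * ‖c - c'‖ / (M + ℓ₁) * (Real.exp ((M + ℓ₁) * θ) - 1) := by gcongr
    _ = _ := by ring

/-- In the frozen estimate evaluated at `ζ i`, the difference at `ζ i` appears on both sides; its
coefficient on the right is below one and is absorbed. -/
theorem ConditionA.norm_sub_zeta_le (hA : ConditionA A f M μ ℓ₁ ℓ₂) (hB : ConditionB τ ζ γ θ)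
    (hq : ℓ₂ / (M + ℓ₁) * (Real.exp ((M + ℓ₁) * θ) - 1) < 1) {x x' : ℝ → E}
    (hx : IsPiecewiseSolution τ ζ (fun t x y => A t x + f t x y) x)
    (hx' : IsPiecewiseSolution τ ζ (fun t x y => A t x + f t x y) x') {i : ℤ} {t : ℝ}
    (ht : t ∈ Icc (τ i) (τ (i + 1))) :
    ‖x (ζ i) - x' (ζ i)‖ ≤ Real.exp ((M + ℓ₁) * θ)
      / (1 - ℓ₂ / (M + ℓ₁) * (Real.exp ((M + ℓ₁) * θ) - 1)) * ‖x t - x' t‖ := by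
  have h := hA.norm_sub_le_of_frozen (hx i) (hx' i) ht (hB.zeta_mem i)
    (hB.abs_sub_le ht (hB.zeta_mem i))
  rw [div_mul_eq_mul_div, le_div_iff₀ (sub_pos.2 hq)]
  linarith

/-- Two solutions of the nonlinear equation diverge at most exponentially, in both directions, and
their difference at the delayed argument is controlled by the present difference. -/
theorem ConditionA.exists_growth (hA : ConditionA A f M μ ℓ₁ ℓ₂) (hB : ConditionB τ ζ γ θ)
    (hq : ℓ₂ / (M + ℓ₁) * (Real.exp ((M + ℓ₁) * θ) - 1) < 1) :
    ∃ C > 0, ∃ κ > 0, ∀ x x' : ℝ → E,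
      IsPiecewiseSolution τ ζ (fun t x y => A t x + f t x y) x →
      IsPiecewiseSolution τ ζ (fun t x y => A t x + f t x y) x' →
      (∀ t, ‖x (γ t) - x' (γ t)‖ ≤ C * ‖x t - x' t‖) ∧
      ∀ s t, ‖x t - x' t‖ ≤ Real.exp (κ * |t - s|) * ‖x s - x' s‖ := by
  set C := Real.exp ((M + ℓ₁) * θ) / (1 - ℓ₂ / (M + ℓ₁) * (Real.exp ((M + ℓ₁) * θ) - 1)) with hC
  have hCpos : 0 < C := div_pos (Real.exp_pos _) (sub_pos.2 hq)
  -- Bounding the delayed difference by `C` times the present one turns the Lipschitz estimate into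
  -- an undelayed one with this rate.
  refine ⟨C, hCpos, M + ℓ₁ + ℓ₂ * C, add_pos (add_pos hA.M_pos hA.l₁_pos)
    (mul_pos hA.l₂_pos hCpos), fun x x' hx hx' => ⟨fun t => ?_, ?_⟩⟩
  · obtain ⟨i, hi⟩ := hB.exists_mem_Ico t
    rw [hB.gamma_eq i t hi]
    exact hA.norm_sub_zeta_le hB hq hx hx' (Ico_subset_Icc_self hi)
  · have hle : ∀ i, ∀ t ∈ Icc (τ i) (τ (i + 1)),
        ‖A t (x t) + f t (x t) (x (ζ i)) - (A t (x' t) + f t (x' t) (x' (ζ i)))‖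
          ≤ (M + ℓ₁ + ℓ₂ * C) * ‖x t - x' t‖ := fun i t ht => by
      have h1 := (A t).le_of_opNorm_le (hA.norm_A_le t) (x t - x' t)
      have h2 := hA.lipschitz t (x t) (x (ζ i)) (x' t) (x' (ζ i))
      have h3 := mul_le_mul_of_nonneg_left (hA.norm_sub_zeta_le hB hq hx hx' ht) hA.l₂_pos.le
      rw [map_sub] at h1
      rw [add_sub_add_comm]
      linarith [norm_add_le (A t (x t) - A t (x' t))
        (f t (x t) (x (ζ i)) - f t (x' t) (x' (ζ i)))]
    refine norm_le_exp_of_one_sided (w := fun t => x t - x' t)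
      ((hx.continuous hB).sub (hx'.continuous hB)) (fun t => ?_) (fun t => ?_)
    · obtain ⟨i, hi⟩ := hB.exists_mem_Ico t
      exact ⟨_, (hx.hasDerivWithinAt_Ici hi).sub (hx'.hasDerivWithinAt_Ici hi),
        hle i t (Ico_subset_Icc_self hi)⟩
    · obtain ⟨i, hi⟩ := hB.exists_mem_Ioc t
      exact ⟨_, (hx.hasDerivWithinAt_Iic hi).sub (hx'.hasDerivWithinAt_Iic hi),
        hle i t (Ioc_subset_Icc_self hi)⟩

variable [CompleteSpace E]

/-- Substituting `x = Φ w` removes the linear term: `w' = Φ⁻¹ f(t, Φ w, c)` is bounded on `[a, b]`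
independently of `w`, so one application of Picard–Lindelöf covers the whole interval. -/
theorem ConditionA.exists_frozen (hΦ : IsCauchyMatrix A Φ) (hA : ConditionA A f M μ ℓ₁ ℓ₂)
    (hf : ∀ x y, Continuous fun t => f t x y) {a b s : ℝ} (hs : s ∈ Icc a b) (v c : E) :
    ∃ x : ℝ → E, x s = v ∧
      ∀ t ∈ Icc a b, HasDerivWithinAt x (A t (x t) + f t (x t) c) (Icc a b) t := by
  obtain ⟨C, hC⟩ := isCompact_Icc.exists_bound_of_continuousOn (s := Icc a b)
    hΦ.continuous.continuousOn
  obtain ⟨C', hC'⟩ := isCompact_Icc.exists_bound_of_continuousOn (s := Icc a b)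
    hΦ.continuous_symm.continuousOn
  have hC0 : 0 ≤ C := (norm_nonneg _).trans (hC s hs)
  have hC0' : 0 ≤ C' := (norm_nonneg _).trans (hC' s hs)
  -- `C' * μ` bounds the speed of `w`, so a ball of radius `C' * μ * (b - a)` cannot be left within
  -- `[a, b]`.
  have hpl : IsPicardLindelof (fun t u => (Φ t).symm (f t (Φ t u) c)) ⟨s, hs⟩ ((Φ s).symm v)
      (C' * μ * (b - a)).toNNReal 0 (C' * μ).toNNReal (C' * (ℓ₁ * C)).toNNReal := by
    have hba : 0 ≤ b - a := sub_nonneg.2 (hs.1.trans hs.2)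
    have hCμ : 0 ≤ C' * μ := mul_nonneg hC0' hA.mu_pos.le
    refine ⟨fun t ht => ?_, fun u _ => ?_, fun t ht u _ => ?_, ?_⟩
    · refine LipschitzWith.lipschitzOnWith (LipschitzWith.of_dist_le_mul fun u u' => ?_)
      rw [Real.coe_toNNReal _ (mul_nonneg hC0' (mul_nonneg hA.l₁_pos.le hC0)), dist_eq_norm,
        dist_eq_norm, ← map_sub, mul_assoc]
      refine ((Φ t).symm : E →L[ℝ] E).le_of_opNorm_le_of_le (hC' t ht) ?_
      have h1 := hA.lipschitz t (Φ t u) c (Φ t u') c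
      rw [sub_self, norm_zero, mul_zero, add_zero, ← map_sub] at h1
      refine h1.trans ?_
      rw [mul_assoc]
      exact mul_le_mul_of_nonneg_left ((Φ t : E →L[ℝ] E).le_of_opNorm_le (hC t ht) _)
        hA.l₁_pos.le
    · exact (hΦ.continuous_symm.clm_apply (hA.continuous_comp hf
        (hΦ.isLinearSolution_apply u).continuous c)).continuousOn
    · rw [Real.coe_toNNReal _ hCμ]
      exact ((Φ t).symm : E →L[ℝ] E).le_of_opNorm_le_of_le (hC' t ht) (hA.norm_f_le _ _ _)
    · rw [Real.coe_toNNReal _ hCμ, Real.coe_toNNReal _ (mul_nonneg hCμ hba), NNReal.coe_zero,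
        sub_zero]
      refine mul_le_mul_of_nonneg_left (max_le ?_ ?_) hCμ
      · linarith [hs.1]
      · linarith [hs.2]
  obtain ⟨w, hw0, hw⟩ := hpl.exists_eq_forall_mem_Icc_hasDerivWithinAt₀
  refine ⟨fun t => Φ t (w t), ?_, fun t ht => ?_⟩
  · change Φ s (w s) = v
    rw [hw0]
    simp
  · have := (hΦ.deriv t).hasDerivWithinAt.clm_apply (hw t ht)
    simpa using this

/-- A frozen value `c` is consistent when the solution frozen at `c` takes the value `c` at `ζ i`.
The map from `c` to that value is a contraction, and `ζ i` may lie before or after `s`. -/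
theorem ConditionA.exists_piece (hΦ : IsCauchyMatrix A Φ) (hA : ConditionA A f M μ ℓ₁ ℓ₂)
    (hf : ∀ x y, Continuous fun t => f t x y) (hB : ConditionB τ ζ γ θ)
    (hq : ℓ₂ / (M + ℓ₁) * (Real.exp ((M + ℓ₁) * θ) - 1) < 1) (i : ℤ) (s : ℝ) (v : E)
    (hs : s ∈ Icc (τ i) (τ (i + 1))) :
    ∃ x : ℝ → E, x s = v ∧ ∀ t ∈ Icc (τ i) (τ (i + 1)),
      HasDerivWithinAt x (A t (x t) + f t (x t) (x (ζ i))) (Icc (τ i) (τ (i + 1))) t := by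
  choose S hS0 hS using hA.exists_frozen hΦ hf hs v
  have hκ : 0 < M + ℓ₁ := add_pos hA.M_pos hA.l₁_pos
  have hq0 : 0 ≤ ℓ₂ / (M + ℓ₁) * (Real.exp ((M + ℓ₁) * θ) - 1) :=
    mul_nonneg (div_nonneg hA.l₂_pos.le hκ.le)
      (sub_nonneg.2 (Real.one_le_exp (mul_nonneg hκ.le hB.theta_pos.le)))
  have hcon : ContractingWith (ℓ₂ / (M + ℓ₁) * (Real.exp ((M + ℓ₁) * θ) - 1)).toNNReal
      fun c => S c (ζ i) := by
    refine ⟨by rwa [Real.toNNReal_lt_one], LipschitzWith.of_dist_le_mul fun c c' => ?_⟩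
    rw [Real.coe_toNNReal _ hq0, dist_eq_norm, dist_eq_norm]
    have := hA.norm_sub_le_of_frozen (hS c) (hS c') hs (hB.zeta_mem i)
      (hB.abs_sub_le hs (hB.zeta_mem i))
    simpa [hS0] using this
  have hfix : S hcon.fixedPoint (ζ i) = hcon.fixedPoint := hcon.fixedPoint_isFixedPt
  refine ⟨S hcon.fixedPoint, hS0 _, ?_⟩
  rw [hfix]
  exact hS _

/-- Starting from the interval containing `t₀`, each neighbouring piece is started at the shared
switching time: at its left end going forward, at its right end going backward. -/
theorem ConditionA.exists_isPiecewiseSolution (hΦ : IsCauchyMatrix A Φ)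
    (hA : ConditionA A f M μ ℓ₁ ℓ₂) (hf : ∀ x y, Continuous fun t => f t x y)
    (hB : ConditionB τ ζ γ θ) (hq : ℓ₂ / (M + ℓ₁) * (Real.exp ((M + ℓ₁) * θ) - 1) < 1)
    (t₀ : ℝ) (v : E) :
    ∃ x, IsPiecewiseSolution τ ζ (fun t x y => A t x + f t x y) x ∧ x t₀ = v := by
  choose! S hS0 hS using hA.exists_piece hΦ hf hB hq
  choose idx hidx using hB.exists_mem_Ico
  let X : ℤ → ℝ → E := fun i => Int.inductionOn' (motive := fun _ => ℝ → E) i (idx t₀)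
    (S (idx t₀) t₀ v) (fun k _ x => S (k + 1) (τ (k + 1)) (x (τ (k + 1))))
    (fun k _ x => S (k - 1) (τ k) (x (τ k)))
  have hX0 : X (idx t₀) = S (idx t₀) t₀ v := Int.inductionOn'_self ..
  have hXs : ∀ i, idx t₀ ≤ i → X (i + 1) = S (i + 1) (τ (i + 1)) (X i (τ (i + 1))) :=
    fun i hi => Int.inductionOn'_add_one hi
  have hXp : ∀ i, i + 1 ≤ idx t₀ → X i = S i (τ (i + 1)) (X (i + 1) (τ (i + 1))) :=
    fun i hi => by
      have : X (i + 1 - 1) = S (i + 1 - 1) (τ (i + 1)) (X (i + 1) (τ (i + 1))) :=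
        Int.inductionOn'_sub_one hi
      rwa [add_sub_cancel_right] at this
  have hl : ∀ i, τ i ∈ Icc (τ i) (τ (i + 1)) := fun i => left_mem_Icc.2 (hB.lt_succ i).le
  have hr : ∀ i, τ (i + 1) ∈ Icc (τ i) (τ (i + 1)) := fun i => right_mem_Icc.2 (hB.lt_succ i).le
  have hXsol : ∀ i, ∀ t ∈ Icc (τ i) (τ (i + 1)),
      HasDerivWithinAt (X i) (A t (X i t) + f t (X i t) (X i (ζ i))) (Icc (τ i) (τ (i + 1))) t := by
    intro i
    rcases lt_trichotomy i (idx t₀) with h | h | h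
    · rw [hXp i h]
      exact hS i _ _ (hr i)
    · subst h
      rw [hX0]
      exact hS _ _ _ (Ico_subset_Icc_self (hidx t₀))
    · obtain ⟨j, rfl⟩ : ∃ j, i = j + 1 := ⟨i - 1, by omega⟩
      rw [hXs j (by omega)]
      exact hS _ _ _ (hl (j + 1))
  have hmatch : ∀ i, X (i + 1) (τ (i + 1)) = X i (τ (i + 1)) := by
    intro i
    rcases le_or_gt (idx t₀) i with h | h
    · rw [hXs i h, hS0 _ _ _ (hl (i + 1))]
    · conv_rhs => rw [hXp i h]
      rw [hS0 _ _ _ (hr i)]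
  -- At the right endpoint `τ (i + 1)` the chosen index is already `i + 1`; the matching of
  -- neighbouring pieces is what covers this point.
  have hglue : ∀ i, ∀ t ∈ Icc (τ i) (τ (i + 1)), X (idx t) t = X i t := by
    intro i t ht
    rcases ht.2.lt_or_eq with h | rfl
    · rw [hB.eq_of_mem_Ico (hidx t) ⟨ht.1, h⟩]
    · rw [hB.eq_of_mem_Ico (hidx (τ (i + 1))) ⟨le_rfl, hB.lt_succ (i + 1)⟩, hmatch]
  refine ⟨fun t => X (idx t) t, fun i t ht => ?_, ?_⟩
  · have := (hXsol i t ht).congr (hglue i) (hglue i t ht)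
    simp only [hglue i t ht, hglue i _ (hB.zeta_mem i)]
    exact this
  · simp only [hX0]
    exact hS0 _ _ _ (Ico_subset_Icc_self (hidx t₀))

end Flow

/-! ### Hölder moduli, interpolation and self-improving bounds -/

section Holder

variable {E : Type*} [NormedAddCommGroup E]

theorem HolderForAllTimes.uniformlyContinuous {G : ℝ → E → E} (h : HolderForAllTimes G) :
    UniformlyContinuousForAllTimes G := by
  obtain ⟨C, hC, c, hc, h⟩ := h
  intro ε hε
  have hC0 : 0 < C := zero_lt_one.trans hC
  have ht : Tendsto (fun r : ℝ => C * r ^ c) (𝓝 0) (𝓝 (C * 0 ^ c)) :=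
    ((Real.continuousAt_rpow_const 0 c (Or.inr hc.1.le)).tendsto).const_mul C
  rw [Real.zero_rpow hc.1.ne', mul_zero] at ht
  obtain ⟨δ, hδ, hlt⟩ := Metric.eventually_nhds_iff.1 (ht.eventually_lt_const hε)
  refine ⟨min δ 1, lt_min hδ one_pos, fun t u v huv => ?_⟩
  refine (h t u v (huv.trans_le (min_le_right _ _))).trans_lt (hlt ?_)
  rw [Real.dist_0_eq_abs, abs_norm]
  exact huv.trans_le (min_le_left _ _)

theorem UniformlyContinuousForAllTimes.continuous {G : ℝ → E → E}
    (h : UniformlyContinuousForAllTimes G) (t : ℝ) : Continuous (G t) := by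
  refine Metric.continuous_iff.2 fun v ε hε => ?_
  obtain ⟨δ, hδ, h⟩ := h ε hε
  refine ⟨δ, hδ, fun u hu => ?_⟩
  rw [dist_eq_norm] at hu ⊢
  exact h t u v hu

theorem holderForAllTimes_of_norm_sub_le {G : ℝ → E → E} {C c : ℝ} (hC : 0 ≤ C)
    (hc : c ∈ Ioo (0 : ℝ) 1)
    (h : ∀ t u v, ‖G t u - G t v‖ ≤ ‖u - v‖ + C * ‖u - v‖ ^ c) : HolderForAllTimes G := by
  -- `C + 1` suffices for the estimate, since `‖u - v‖ ≤ ‖u - v‖ ^ c` at distances below one; the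
  -- extra unit makes the constant exceed one even if `C = 0`.
  refine ⟨C + 2, by linarith, c, hc, fun t u v huv => (h t u v).trans ?_⟩
  have h1 : ‖u - v‖ ≤ ‖u - v‖ ^ c := by
    rcases (norm_nonneg (u - v)).eq_or_lt with h0 | h0
    · rw [← h0, Real.zero_rpow hc.1.ne']
    · simpa using Real.rpow_le_rpow_of_exponent_ge h0 huv.le hc.2.le
  nlinarith [norm_nonneg (u - v)]

/-- Interpolation between a bound and an exponentially growing Lipschitz bound. -/
theorem le_interpolate {a B N κ r δ c : ℝ} (ha : 0 ≤ a) (hN : 0 ≤ N) (hδ : 0 ≤ δ)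
    (hc : c ∈ Ioo (0 : ℝ) 1) (h1 : a ≤ B) (h2 : a ≤ N * (Real.exp (κ * r) * δ)) :
    a ≤ B ^ (1 - c) * N ^ c * δ ^ c * Real.exp (c * κ * r) := by
  calc a = a ^ (1 - c) * a ^ c := by
        rw [← Real.rpow_add_of_nonneg ha (sub_nonneg.2 hc.2.le) hc.1.le, sub_add_cancel,
          Real.rpow_one]
    _ ≤ B ^ (1 - c) * (N * (Real.exp (κ * r) * δ)) ^ c :=
        mul_le_mul (Real.rpow_le_rpow ha h1 (sub_nonneg.2 hc.2.le))
          (Real.rpow_le_rpow ha h2 hc.1.le) (Real.rpow_nonneg ha _)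
          (Real.rpow_nonneg (ha.trans h1) _)
    _ = _ := by
        rw [Real.mul_rpow hN (mul_nonneg (Real.exp_pos _).le hδ),
          Real.mul_rpow (Real.exp_pos _).le hδ, ← Real.exp_mul,
          show κ * r * c = c * κ * r by ring]
        ring

/-- A bounded function whose every upper bound `B` can be improved to `q * B + d`, with `q < 1`,
is at most `d / (1 - q)`. -/
theorem le_div_of_improve_bound {ι : Type*} [Nonempty ι] {φ : ι → ℝ} {q d : ℝ} (hq : q < 1)
    (h0 : ∀ i, 0 ≤ φ i) (hb : BddAbove (range φ))
    (h : ∀ B, 0 ≤ B → (∀ i, φ i ≤ B) → ∀ i, φ i ≤ q * B + d) (i : ι) : φ i ≤ d / (1 - q) := by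
  have hle : ∀ i, φ i ≤ ⨆ j, φ j := le_ciSup hb
  have h1 : ⨆ j, φ j ≤ q * (⨆ j, φ j) + d :=
    ciSup_le (h _ ((h0 i).trans (hle i)) hle)
  refine (hle i).trans ?_
  rw [le_div_iff₀ (sub_pos.2 hq)]
  linarith

end Holder

/-! ### Construction of the conjugacy and its Hölder bounds -/

section Conjugacy

variable {E : Type*} [NormedAddCommGroup E] [NormedSpace ℝ E]
  {A : ℝ → E →L[ℝ] E} {Φ : ℝ → E ≃L[ℝ] E} {P : E →L[ℝ] E} {K α : ℝ} {f : ℝ → E → E → E}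
  {τ ζ : ℤ → ℝ} {γ : ℝ → ℝ} {M μ ℓ₁ ℓ₂ θ : ℝ}

theorem ConditionA.norm_forcing_sub_le (hA : ConditionA A f M μ ℓ₁ ℓ₂) (x x' : ℝ → E) (s : ℝ) :
    ‖forcing f γ x s - forcing f γ x' s‖ ≤ 2 * μ := by
  have h1 : ‖forcing f γ x s‖ ≤ μ := hA.norm_forcing_le x s
  have h2 : ‖forcing f γ x' s‖ ≤ μ := hA.norm_forcing_le x' s
  exact (norm_sub_le _ _).trans (by linarith)

theorem IsDichotomy.norm_greenOperator_forcing_le (h : IsDichotomy A Φ P K α)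
    (hA : ConditionA A f M μ ℓ₁ ℓ₂) (x : ℝ → E) (t : ℝ) :
    ‖greenOperator Φ P (forcing f γ x) t‖ ≤ 2 * K / α * μ := by
  have := h.norm_greenOperator_le (t₀ := 0) le_rfl h.alpha_pos hA.mu_pos.le
    (by simpa using hA.norm_forcing_le (γ := γ) x) t
  simpa using this

theorem exp_gamma_le (hB : ConditionB τ ζ γ θ) {β : ℝ} (hβ : 0 ≤ β) (s t₀ : ℝ) :
    Real.exp (β * |γ s - t₀|) ≤ Real.exp (β * θ) * Real.exp (β * |s - t₀|) := by
  rw [← Real.exp_add, ← mul_add]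
  refine Real.exp_le_exp.2 (mul_le_mul_of_nonneg_left ?_ hβ)
  linarith [abs_sub_le (γ s) s t₀, hB.abs_gamma_sub_le s]

variable [CompleteSpace E]

theorem IsDichotomy.continuous_greenOperator_forcing (h : IsDichotomy A Φ P K α)
    (hA : ConditionA A f M μ ℓ₁ ℓ₂) (hf : ∀ x y, Continuous fun t => f t x y)
    (hB : ConditionB τ ζ γ θ) {x : ℝ → E} (hx : Continuous x) :
    Continuous (greenOperator Φ P (forcing f γ x)) :=
  (h.isMildSolution_greenOperator (hA.stronglyMeasurable_forcing hf hB hx)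
    (hA.norm_forcing_le x)).continuous h.cauchy (hA.stronglyMeasurable_forcing hf hB hx)
    (hA.norm_forcing_le x)

theorem IsDichotomy.norm_greenOperator_forcing_sub_le (h : IsDichotomy A Φ P K α)
    (hA : ConditionA A f M μ ℓ₁ ℓ₂) (hf : ∀ x y, Continuous fun t => f t x y)
    (hB : ConditionB τ ζ γ θ) {x x' : ℝ → E} (hx : Continuous x) (hx' : Continuous x')
    {D β t₀ : ℝ} (hβ : 0 ≤ β) (hβα : β < α) (hD : 0 ≤ D)
    (hle : ∀ s, ‖forcing f γ x s - forcing f γ x' s‖ ≤ D * Real.exp (β * |s - t₀|)) (t : ℝ) :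
    ‖greenOperator Φ P (forcing f γ x) t - greenOperator Φ P (forcing f γ x') t‖
      ≤ 2 * K / (α - β) * D * Real.exp (β * |t - t₀|) := by
  rw [h.greenOperator_sub (hA.stronglyMeasurable_forcing hf hB hx) (hA.norm_forcing_le x)
    (hA.stronglyMeasurable_forcing hf hB hx') (hA.norm_forcing_le x')]
  exact h.norm_greenOperator_le hβ hβα hD hle t

/-- Dependence of the solutions of `z = 𝒢 (f (·, y + z, (y + z) ∘ γ))` on `y`, in exponentially
weighted norms. -/
theorem IsDichotomy.norm_fixed_sub_le (h : IsDichotomy A Φ P K α)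
    (hA : ConditionA A f M μ ℓ₁ ℓ₂) (hf : ∀ x y, Continuous fun t => f t x y)
    (hB : ConditionB τ ζ γ θ) {y y' z z' : ℝ → E} (hy : Continuous y) (hy' : Continuous y')
    (hzc : Continuous z) (hzc' : Continuous z')
    (hz : ∀ t, z t = greenOperator Φ P (forcing f γ fun s => y s + z s) t)
    (hz' : ∀ t, z' t = greenOperator Φ P (forcing f γ fun s => y' s + z' s) t)
    {D β t₀ : ℝ} (hβ : 0 ≤ β) (hβα : β < α)
    (hq : 2 * K / (α - β) * (ℓ₁ + ℓ₂ * Real.exp (β * θ)) < 1) (hD : 0 ≤ D)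
    (hle : ∀ s, ‖forcing f γ (fun s => y s + z' s) s - forcing f γ (fun s => y' s + z' s) s‖
      ≤ D * Real.exp (β * |s - t₀|)) (t : ℝ) :
    ‖z t - z' t‖ ≤ 2 * K / (α - β) * D
      / (1 - 2 * K / (α - β) * (ℓ₁ + ℓ₂ * Real.exp (β * θ))) * Real.exp (β * |t - t₀|) := by
  have hbound : ∀ t, ‖z t - z' t‖ ≤ 2 * K / α * μ + 2 * K / α * μ := fun t => by
    refine (norm_sub_le _ _).trans (add_le_add ?_ ?_)
    · rw [hz]
      exact h.norm_greenOperator_forcing_le hA _ t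
    · rw [hz']
      exact h.norm_greenOperator_forcing_le hA _ t
  -- The weighted difference is bounded a priori because `z` and `z'` are, being Green integrals of
  -- bounded forcings, and the weight is at least one.
  have key := le_div_of_improve_bound (φ := fun t => ‖z t - z' t‖ / Real.exp (β * |t - t₀|))
    (d := 2 * K / (α - β) * D) hq (fun t => div_nonneg (norm_nonneg _) (Real.exp_pos _).le)
    ⟨2 * K / α * μ + 2 * K / α * μ, by
      rintro _ ⟨t, rfl⟩
      exact (div_le_self (norm_nonneg _)
        (Real.one_le_exp (mul_nonneg hβ (abs_nonneg _)))).trans (hbound t)⟩ ?_ t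
  · rwa [div_le_iff₀ (Real.exp_pos _)] at key
  · intro B hB0 hb t
    simp only [div_le_iff₀ (Real.exp_pos _)] at hb ⊢
    have hforce : ∀ s, ‖forcing f γ (fun s => y s + z s) s - forcing f γ (fun s => y' s + z' s) s‖
        ≤ ((ℓ₁ + ℓ₂ * Real.exp (β * θ)) * B + D) * Real.exp (β * |s - t₀|) := fun s => by
      have h1 : ‖forcing f γ (fun s => y s + z s) s - forcing f γ (fun s => y s + z' s) s‖
          ≤ ℓ₁ * ‖z s - z' s‖ + ℓ₂ * ‖z (γ s) - z' (γ s)‖ := by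
        simpa only [forcing, add_sub_add_left_eq_sub] using
          hA.lipschitz s (y s + z s) (y (γ s) + z (γ s)) (y s + z' s) (y (γ s) + z' (γ s))
      have h2 : ℓ₁ * ‖z s - z' s‖ ≤ ℓ₁ * (B * Real.exp (β * |s - t₀|)) :=
        mul_le_mul_of_nonneg_left (hb s) hA.l₁_pos.le
      have h3 : ℓ₂ * ‖z (γ s) - z' (γ s)‖
          ≤ ℓ₂ * (B * (Real.exp (β * θ) * Real.exp (β * |s - t₀|))) :=
        mul_le_mul_of_nonneg_left ((hb (γ s)).trans
          (mul_le_mul_of_nonneg_left (exp_gamma_le hB hβ s t₀) hB0)) hA.l₂_pos.le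
      refine (norm_sub_le_norm_sub_add_norm_sub _
        (forcing f γ (fun s => y s + z' s) s) _).trans ?_
      linarith [hle s]
    have h4 := h.norm_greenOperator_forcing_sub_le hA hf hB (hy.add hzc) (hy'.add hzc') hβ hβα
      (add_nonneg (mul_nonneg (add_nonneg hA.l₁_pos.le
        (mul_nonneg hA.l₂_pos.le (Real.exp_pos _).le)) hB0) hD) hforce t
    rw [hz t, hz' t]
    refine h4.trans_eq ?_
    ring

/-- Banach's theorem on bounded continuous functions; `y` may be unbounded, but it cancels in
differences of forcing arguments. -/
theorem IsDichotomy.exists_fixed (h : IsDichotomy A Φ P K α)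
    (hA : ConditionA A f M μ ℓ₁ ℓ₂) (hf : ∀ x y, Continuous fun t => f t x y)
    (hB : ConditionB τ ζ γ θ) (hcontr : 2 * (ℓ₁ + ℓ₂) * K < α) {y : ℝ → E}
    (hy : Continuous y) :
    ∃ z : ℝ → E, Continuous z ∧
      ∀ t, z t = greenOperator Φ P (forcing f γ fun s => y s + z s) t := by
  have hK : 0 ≤ K := zero_le_one.trans h.one_le
  have hℓ : 0 ≤ ℓ₁ + ℓ₂ := (add_pos hA.l₁_pos hA.l₂_pos).le
  let T : BoundedContinuousFunction ℝ E → BoundedContinuousFunction ℝ E := fun z =>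
    BoundedContinuousFunction.ofNormedAddCommGroup
      (greenOperator Φ P (forcing f γ fun s => y s + z s))
      (h.continuous_greenOperator_forcing hA hf hB (hy.add z.continuous)) (2 * K / α * μ)
      (h.norm_greenOperator_forcing_le hA _)
  have hq0 : 0 ≤ 2 * K / α * (ℓ₁ + ℓ₂) :=
    mul_nonneg (div_nonneg (mul_nonneg two_pos.le hK) h.alpha_pos.le) hℓ
  have hT : ContractingWith (2 * K / α * (ℓ₁ + ℓ₂)).toNNReal T := by
    refine ⟨?_, LipschitzWith.of_dist_le_mul fun z z' => ?_⟩
    · rw [Real.toNNReal_lt_one, div_mul_eq_mul_div, div_lt_one h.alpha_pos]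
      linarith
    · rw [Real.coe_toNNReal _ hq0]
      refine (BoundedContinuousFunction.dist_le (mul_nonneg hq0 dist_nonneg)).2 fun t => ?_
      have hforce : ∀ s,
          ‖forcing f γ (fun s => y s + z s) s - forcing f γ (fun s => y s + z' s) s‖
            ≤ ((ℓ₁ + ℓ₂) * dist z z') * Real.exp (0 * |s - 0|) := fun s => by
        have h1 := hA.lipschitz s (y s + z s) (y (γ s) + z (γ s)) (y s + z' s)
          (y (γ s) + z' (γ s))
        simp only [add_sub_add_left_eq_sub, ← dist_eq_norm] at h1
        have h2 := mul_le_mul_of_nonneg_left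
          (BoundedContinuousFunction.dist_coe_le_dist (f := z) (g := z') s) hA.l₁_pos.le
        have h3 := mul_le_mul_of_nonneg_left
          (BoundedContinuousFunction.dist_coe_le_dist (f := z) (g := z') (γ s)) hA.l₂_pos.le
        rw [zero_mul, Real.exp_zero, mul_one, ← dist_eq_norm]
        exact h1.trans (by linarith)
      have h4 := h.norm_greenOperator_forcing_sub_le hA hf hB (hy.add z.continuous)
        (hy.add z'.continuous) le_rfl h.alpha_pos (mul_nonneg hℓ dist_nonneg) hforce t
      rw [zero_mul, Real.exp_zero, mul_one, sub_zero, ← mul_assoc] at h4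
      rw [dist_eq_norm]
      exact h4
  refine ⟨hT.fixedPoint, hT.fixedPoint.continuous, fun t => ?_⟩
  exact (DFunLike.congr_fun (hT.fixedPoint_isFixedPt : T hT.fixedPoint = _) t).symm

/-- The weighted estimate with `β = 0` and `D = 0`. Boundedness of `z` need not be assumed, as the
fixed-point equation forces it. -/
theorem IsDichotomy.fixed_unique (h : IsDichotomy A Φ P K α)
    (hA : ConditionA A f M μ ℓ₁ ℓ₂) (hf : ∀ x y, Continuous fun t => f t x y)
    (hB : ConditionB τ ζ γ θ) (hcontr : 2 * (ℓ₁ + ℓ₂) * K < α) {y z z' : ℝ → E}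
    (hy : Continuous y) (hzc : Continuous z) (hzc' : Continuous z')
    (hz : ∀ t, z t = greenOperator Φ P (forcing f γ fun s => y s + z s) t)
    (hz' : ∀ t, z' t = greenOperator Φ P (forcing f γ fun s => y s + z' s) t) : z = z' := by
  ext t
  have hq : 2 * K / (α - 0) * (ℓ₁ + ℓ₂ * Real.exp (0 * θ)) < 1 := by
    rw [zero_mul, Real.exp_zero, sub_zero, mul_one, div_mul_eq_mul_div, div_lt_one h.alpha_pos]
    linarith
  have := h.norm_fixed_sub_le hA hf hB hy hy hzc hzc' hz hz' (t₀ := 0) le_rfl h.alpha_pos hq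
    le_rfl (fun s => by simp) t
  rw [mul_zero, zero_div, zero_mul] at this
  exact sub_eq_zero.1 (norm_le_zero_iff.1 this)

theorem IsDichotomy.isLinearSolution_sub_green (h : IsDichotomy A Φ P K α)
    (hA : ConditionA A f M μ ℓ₁ ℓ₂) (hf : ∀ x y, Continuous fun t => f t x y)
    (hB : ConditionB τ ζ γ θ) {x : ℝ → E}
    (hx : IsPiecewiseSolution τ ζ (fun t x y => A t x + f t x y) x) :
    IsLinearSolution A fun t => x t - greenOperator Φ P (forcing f γ x) t :=
  ((hx.isSolution hB).isMildSolution h.cauchy hA hf hB).isLinearSolution_sub h.cauchy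
    (h.isMildSolution_greenOperator (hA.stronglyMeasurable_forcing hf hB (hx.continuous hB))
      (hA.norm_forcing_le x))

theorem IsDichotomy.isPiecewiseSolution_add_fixed (h : IsDichotomy A Φ P K α)
    (hA : ConditionA A f M μ ℓ₁ ℓ₂) (hf : ∀ x y, Continuous fun t => f t x y)
    (hB : ConditionB τ ζ γ θ) {y z : ℝ → E} (hy : IsLinearSolution A y) (hzc : Continuous z)
    (hz : ∀ t, z t = greenOperator Φ P (forcing f γ fun s => y s + z s) t) :
    IsPiecewiseSolution τ ζ (fun t x y => A t x + f t x y) fun t => y t + z t := by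
  have hc : Continuous fun t => y t + z t := hy.continuous.add hzc
  refine IsMildSolution.isPiecewiseSolution h.cauchy hA hf hB hc
    (IsMildSolution.linear_add h.cauchy hy ?_)
  rw [funext hz]
  simp only [← hz]
  exact h.isMildSolution_greenOperator (hA.stronglyMeasurable_forcing hf hB hc)
    (hA.norm_forcing_le _)

/-- At `c = 0` all the conditions are strict, the last one being `2K(ℓ₁ + ℓ₂)/α < 1`; by continuity
they persist for small `c > 0`. -/
theorem exists_holder_exponent (hα : 0 < α) (hcontr : 2 * (ℓ₁ + ℓ₂) * K < α) (M κ θ : ℝ) :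
    ∃ c ∈ Ioo (0 : ℝ) 1, c * M < α ∧ c * κ < α ∧
      2 * K / (α - c * M) * (ℓ₁ + ℓ₂ * Real.exp (c * M * θ)) < 1 := by
  have hq : ContinuousAt
      (fun c : ℝ => 2 * K / (α - c * M) * (ℓ₁ + ℓ₂ * Real.exp (c * M * θ))) 0 := by
    have h0 : α - 0 * M ≠ 0 := by simpa using hα.ne'
    fun_prop (disch := exact h0)
  have h1 : ∀ᶠ c : ℝ in 𝓝 0, 2 * K / (α - c * M) * (ℓ₁ + ℓ₂ * Real.exp (c * M * θ)) < 1 := by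
    refine hq.eventually_lt_const ?_
    beta_reduce
    rw [zero_mul, zero_mul, Real.exp_zero, sub_zero, mul_one, div_mul_eq_mul_div, div_lt_one hα]
    linarith
  have h2 : ∀ N : ℝ, ∀ᶠ c : ℝ in 𝓝 0, c * N < α := fun N =>
    (continuous_mul_const N).continuousAt.eventually_lt_const (by simpa using hα)
  obtain ⟨c, ⟨⟨hc1, hc2, hc3⟩, hc4⟩, hc0⟩ := (((h1.and ((h2 M).and (h2 κ))).and
    (eventually_lt_nhds one_pos)).filter_mono nhdsWithin_le_nhds |>.and
      (self_mem_nhdsWithin (a := (0 : ℝ)) (s := Ioi 0))).exists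
  exact ⟨c, ⟨hc0, hc4⟩, hc2, hc3, hc1⟩

theorem IsDichotomy.holderStronglyTopologicallyEquivalent (h : IsDichotomy A Φ P K α)
    (hA : ConditionA A f M μ ℓ₁ ℓ₂) (hf : ∀ x y, Continuous fun t => f t x y)
    (hB : ConditionB τ ζ γ θ) (hcontr : 2 * (ℓ₁ + ℓ₂) * K < α)
    (hsmall : F₁ M ℓ₁ θ * ℓ₂ * θ < 1) :
    HolderStronglyTopologicallyEquivalent (IsLinearSolution A)
      (IsSolution τ γ (fun t x y => A t x + f t x y)) := by
  rw [F₁_mul_eq (add_pos hA.M_pos hA.l₁_pos) hB.theta_pos] at hsmall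
  have hK : 0 ≤ K := zero_le_one.trans h.one_le
  obtain ⟨C, hC, κ, hκ, hgrowth⟩ := hA.exists_growth hB hsmall
  obtain ⟨c, hc, hcM, hcκ, hq⟩ := exists_holder_exponent (κ := κ) (θ := θ) (M := M)
    h.alpha_pos hcontr
  choose X hX hX0 using hA.exists_isPiecewiseSolution h.cauchy hf hB hsmall
  have hXc : ∀ t ξ, Continuous (X t ξ) := fun t ξ => (hX t ξ).continuous hB
  -- Uniqueness: the growth bound from a zero difference at time `t` forces zero difference
  -- everywhere.
  have hXeq : ∀ {x : ℝ → E}, IsPiecewiseSolution τ ζ (fun t x y => A t x + f t x y) x →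
      ∀ t, X t (x t) = x := fun {x} hx t => by
    ext s
    have := (hgrowth _ _ (hX t (x t)) hx).2 t s
    rw [hX0, sub_self, norm_zero, mul_zero] at this
    exact sub_eq_zero.1 (norm_le_zero_iff.1 this)
  let Y : ℝ → E → ℝ → E := fun t ν s => Φ s ((Φ t).symm ν)
  have hY : ∀ t ν, IsLinearSolution A (Y t ν) := fun t ν => h.cauchy.isLinearSolution_apply _
  have hY0 : ∀ t ν, Y t ν t = ν := fun t ν => (Φ t).apply_symm_apply ν
  have hYeq : ∀ {y : ℝ → E}, IsLinearSolution A y → ∀ t, Y t (y t) = y := fun {y} hy t =>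
    funext fun s => (h.cauchy.eq_apply hy t s).symm
  choose Z hZc hZ using fun t ν => h.exists_fixed hA hf hB hcontr (hY t ν).continuous
  have hYZ : ∀ t ν, IsPiecewiseSolution τ ζ (fun t x y => A t x + f t x y)
      fun s => Y t ν s + Z t ν s := fun t ν =>
    h.isPiecewiseSolution_add_fixed hA hf hB (hY t ν) (hZc t ν) (hZ t ν)
  let H : ℝ → E → E := fun t ξ => ξ - greenOperator Φ P (forcing f γ (X t ξ)) t
  let L : ℝ → E → E := fun t ν => ν + Z t ν t
  have hHsol : ∀ {x : ℝ → E}, IsPiecewiseSolution τ ζ (fun t x y => A t x + f t x y) x →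
      ∀ t, H t (x t) = x t - greenOperator Φ P (forcing f γ x) t := fun {x} hx t => by
    simp only [H, hXeq hx t]
  -- The correction depends only on the solution `y`, not on the time at which it is sampled, so `L`
  -- along `y` is one global function.
  have hLsol : ∀ {y : ℝ → E}, IsLinearSolution A y → ∀ s t, L t (y t) = y t + Z s (y s) t := by
    intro y hy s t
    have : Z t (y t) = Z s (y s) := by
      refine h.fixed_unique hA hf hB hcontr hy.continuous (hZc _ _) (hZc _ _) ?_ ?_
      · simpa only [hYeq hy t] using hZ t (y t)
      · simpa only [hYeq hy s] using hZ s (y s)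
    simp only [L, this]
  have hleft : ∀ t, Function.LeftInverse (L t) (H t) := fun t ξ => by
    set g := greenOperator Φ P (forcing f γ (X t ξ)) with hg
    have hy : IsLinearSolution A fun s => X t ξ s - g s :=
      h.isLinearSolution_sub_green hA hf hB (hX t ξ)
    have hHξ : H t ξ = X t ξ t - g t := by simp only [H, hX0, hg]
    -- For `y = X - g` one has `y + g = X`, so `g = 𝒢 f(·, X, X ∘ γ)` is a fixed point for `y`,
    -- hence the only one.
    have hz : Z t (H t ξ) = g := by
      refine h.fixed_unique hA hf hB hcontr hy.continuous (hZc _ _)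
        (h.continuous_greenOperator_forcing hA hf hB (hXc t ξ)) ?_ ?_
      · have := hZ t (H t ξ)
        rw [hHξ] at this ⊢
        simpa only [hYeq hy t] using this
      · intro s
        simp only [sub_add_cancel]
        rw [hg]
    change H t ξ + Z t (H t ξ) t = ξ
    rw [hz, hHξ, sub_add_cancel, hX0]
  have hright : ∀ t, Function.RightInverse (L t) (H t) := fun t ν => by
    have h1 := hHsol (hYZ t ν) t
    rw [← hZ t ν t, add_sub_cancel_right, hY0] at h1
    exact h1
  -- The two bounds to interpolate are `2μ` and `(ℓ₁ + ℓ₂ C) exp(κ|s - t|) ‖ξ - ξ'‖`; after the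
  -- Green operator the weight centred at `t` equals one at time `t`.
  have hHsub : ∀ t ξ ξ', ‖H t ξ - H t ξ'‖ ≤ ‖ξ - ξ'‖ + 2 * K / (α - c * κ) *
      ((2 * μ) ^ (1 - c) * (ℓ₁ + ℓ₂ * C) ^ c) * ‖ξ - ξ'‖ ^ c := fun t ξ ξ' => by
    have hN : 0 ≤ ℓ₁ + ℓ₂ * C := (add_pos hA.l₁_pos (mul_pos hA.l₂_pos hC)).le
    have hforce : ∀ s, ‖forcing f γ (X t ξ) s - forcing f γ (X t ξ') s‖
        ≤ (2 * μ) ^ (1 - c) * (ℓ₁ + ℓ₂ * C) ^ c * ‖ξ - ξ'‖ ^ c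
          * Real.exp (c * κ * |s - t|) := fun s => by
      refine le_interpolate (norm_nonneg _) hN (norm_nonneg _) hc
        (hA.norm_forcing_sub_le _ _ s) ?_
      have h1 := hA.lipschitz s (X t ξ s) (X t ξ (γ s)) (X t ξ' s) (X t ξ' (γ s))
      obtain ⟨h2, h3⟩ := hgrowth _ _ (hX t ξ) (hX t ξ')
      have h4 := h3 t s
      rw [hX0, hX0] at h4
      have h5 := mul_le_mul_of_nonneg_left (h2 s) hA.l₂_pos.le
      have h6 := mul_le_mul_of_nonneg_left h4 hN
      simp only [forcing]
      linarith
    have h1 := h.norm_greenOperator_forcing_sub_le hA hf hB (hXc t ξ) (hXc t ξ')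
      (mul_pos hc.1 hκ).le hcκ (mul_nonneg (mul_nonneg (Real.rpow_nonneg
        (mul_nonneg two_pos.le hA.mu_pos.le) _) (Real.rpow_nonneg hN _))
        (Real.rpow_nonneg (norm_nonneg _) _)) hforce t
    rw [sub_self, abs_zero, mul_zero, Real.exp_zero, mul_one] at h1
    have h2 : H t ξ - H t ξ' = (ξ - ξ') - (greenOperator Φ P (forcing f γ (X t ξ)) t
        - greenOperator Φ P (forcing f γ (X t ξ')) t) := sub_sub_sub_comm _ _ _ _
    rw [h2]
    refine (norm_sub_le _ _).trans (add_le_add_right (h1.trans_eq ?_) _)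
    ring
  -- Only the linear solutions differ in the forcing estimate, so the rate is `M`, with a factor
  -- `exp(M θ)` for the delayed argument; the change in `Z` is absorbed through the denominator.
  have hLsub : ∀ t ν ν', ‖L t ν - L t ν'‖ ≤ ‖ν - ν'‖ + 2 * K / (α - c * M) *
      ((2 * μ) ^ (1 - c) * (ℓ₁ + ℓ₂ * Real.exp (M * θ)) ^ c)
        / (1 - 2 * K / (α - c * M) * (ℓ₁ + ℓ₂ * Real.exp (c * M * θ))) * ‖ν - ν'‖ ^ c := by
    intro t ν ν'
    have hN : 0 ≤ ℓ₁ + ℓ₂ * Real.exp (M * θ) :=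
      (add_pos hA.l₁_pos (mul_pos hA.l₂_pos (Real.exp_pos _))).le
    have hYsub : ∀ s, ‖Y t ν s - Y t ν' s‖ ≤ Real.exp (M * |s - t|) * ‖ν - ν'‖ := fun s => by
      have := ((hY t ν).sub (hY t ν')).norm_le hA.norm_A_le t s
      rwa [hY0, hY0] at this
    have hforce : ∀ s, ‖forcing f γ (fun s => Y t ν s + Z t ν' s) s
        - forcing f γ (fun s => Y t ν' s + Z t ν' s) s‖
        ≤ (2 * μ) ^ (1 - c) * (ℓ₁ + ℓ₂ * Real.exp (M * θ)) ^ c * ‖ν - ν'‖ ^ c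
          * Real.exp (c * M * |s - t|) := fun s => by
      refine le_interpolate (norm_nonneg _) hN (norm_nonneg _) hc
        (hA.norm_forcing_sub_le _ _ s) ?_
      have h1 := hA.lipschitz s (Y t ν s + Z t ν' s) (Y t ν (γ s) + Z t ν' (γ s))
        (Y t ν' s + Z t ν' s) (Y t ν' (γ s) + Z t ν' (γ s))
      simp only [add_sub_add_right_eq_sub] at h1
      have h2 := mul_le_mul_of_nonneg_left (hYsub s) hA.l₁_pos.le
      have h3 := mul_le_mul_of_nonneg_left ((hYsub (γ s)).trans (mul_le_mul_of_nonneg_right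
        (exp_gamma_le hB hA.M_pos.le s t) (norm_nonneg _))) hA.l₂_pos.le
      simp only [forcing]
      linarith
    have h1 := h.norm_fixed_sub_le hA hf hB (hY t ν).continuous (hY t ν').continuous (hZc t ν)
      (hZc t ν') (hZ t ν) (hZ t ν') (mul_pos hc.1 hA.M_pos).le hcM hq
      (mul_nonneg (mul_nonneg (Real.rpow_nonneg
        (mul_nonneg two_pos.le hA.mu_pos.le) _) (Real.rpow_nonneg hN _))
        (Real.rpow_nonneg (norm_nonneg _) _)) hforce t
    rw [sub_self, abs_zero, mul_zero, Real.exp_zero, mul_one] at h1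
    have h2 : L t ν - L t ν' = (ν - ν') + (Z t ν t - Z t ν' t) := add_sub_add_comm _ _ _ _
    rw [h2]
    refine (norm_add_le _ _).trans (add_le_add_right (h1.trans_eq ?_) _)
    ring
  have hμc : 0 ≤ (2 * μ) ^ (1 - c) := Real.rpow_nonneg (mul_nonneg two_pos.le hA.mu_pos.le) _
  have hHholder : HolderForAllTimes H := by
    refine holderForAllTimes_of_norm_sub_le ?_ hc hHsub
    have h1 : 0 ≤ α - c * κ := (sub_pos.2 hcκ).le
    have h2 : 0 ≤ (ℓ₁ + ℓ₂ * C) ^ c :=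
      Real.rpow_nonneg (add_pos hA.l₁_pos (mul_pos hA.l₂_pos hC)).le _
    positivity
  have hLholder : HolderForAllTimes L := by
    refine holderForAllTimes_of_norm_sub_le ?_ hc hLsub
    have h1 : 0 ≤ α - c * M := (sub_pos.2 hcM).le
    have h2 : 0 ≤ (ℓ₁ + ℓ₂ * Real.exp (M * θ)) ^ c :=
      Real.rpow_nonneg (add_pos hA.l₁_pos (mul_pos hA.l₂_pos (Real.exp_pos _))).le _
    have h3 := (sub_pos.2 hq).le
    positivity
  have hHu := hHholder.uniformlyContinuous
  have hLu := hLholder.uniformlyContinuous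
  refine ⟨fun t => ⟨⟨H t, L t, hleft t, hright t⟩, hHu.continuous t, hLu.continuous t⟩,
    ⟨⟨2 * K / α * μ, fun t ξ => ?_⟩, ⟨2 * K / α * μ, fun t ν => ?_⟩, fun x hx => ?_,
      fun y hy => ?_⟩, hHu, hLu, hHholder, hLholder⟩
  · change ‖H t ξ - ξ‖ ≤ _
    simp only [H, sub_sub_cancel_left, norm_neg]
    exact h.norm_greenOperator_forcing_le hA _ t
  · change ‖L t ν - ν‖ ≤ _
    simp only [L, add_sub_cancel_left]
    rw [hZ]
    exact h.norm_greenOperator_forcing_le hA _ t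
  · change IsLinearSolution A fun t => H t (x t)
    have hx' := hx.isPiecewiseSolution h.cauchy hA hf hB
    rw [funext (hHsol hx')]
    exact h.isLinearSolution_sub_green hA hf hB hx'
  · change IsSolution τ γ _ fun t => L t (y t)
    rw [funext (hLsol hy 0)]
    have := hYZ 0 (y 0)
    rw [hYeq hy 0] at this
    exact this.isSolution hB

end Conjugacy

end DEPCAG

theorem corollary3p2 {E : Type*} [NormedAddCommGroup E] [NormedSpace ℝ E] [FiniteDimensional ℝ E]
    (A : ℝ → E →L[ℝ] E) (f : ℝ → E → E → E) (τ ζ : ℤ → ℝ) (γ : ℝ → ℝ)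
    (M μ ℓ₁ ℓ₂ θ K α : ℝ)
    (hA : Continuous A) (hf : ∀ x y, Continuous fun t => f t x y)
    (condA : DEPCAG.ConditionA A f M μ ℓ₁ ℓ₂)
    (condB : DEPCAG.ConditionB τ ζ γ θ)
    (hdich : DEPCAG.HasExponentialDichotomy A K α)
    (hcontr : 2 * (ℓ₁ + ℓ₂) * K < α)
    (hsmall : DEPCAG.F₁ M ℓ₁ θ * ℓ₂ * θ < 1) :
    DEPCAG.StronglyTopologicallyEquivalent (DEPCAG.IsLinearSolution A)
        (DEPCAG.IsSolution τ γ (fun t x y => A t x + f t x y)) ∧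
      (α < M →
        DEPCAG.HolderStronglyTopologicallyEquivalent (DEPCAG.IsLinearSolution A)
          (DEPCAG.IsSolution τ γ (fun t x y => A t x + f t x y))) := by
  have : CompleteSpace E := FiniteDimensional.complete ℝ E
  obtain ⟨hK, hα, Φ, hΦ, P, -, hs, hu⟩ := hdich
  have h : DEPCAG.IsDichotomy A Φ P K α := ⟨hK, hα, hΦ, hs, hu⟩
  have hequiv := h.holderStronglyTopologicallyEquivalent condA hf condB hcontr hsmall
  refine ⟨?_, fun _ => hequiv⟩
  obtain ⟨H, hH, hHu, hLu, -⟩ := hequiv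
  exact ⟨H, hH, hHu, hLu⟩
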